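/- Let $T>0$, let $\Theta\subset\mathbb{R}^p$, let $C\in\mathbb{R}^{d'\times d}$, and for every $\theta\in\Theta$ let $A_\theta\in L^2([0,T],\mathbb{R}^{d\times d})$ and $r_\theta\in L^2([0,T],\mathbb{R}^d)$. Let $\zeta\in L^\infty([0,T],\mathbb{R}^{d'})$, let $\lambda>0$ and let $Q\in\mathbb{R}^{d\times d}$ be symmetric positive definite. Solutions of differential equations on $[0,T]$ are understood in the Carathéodory sense (continuous functions satisfying the integrated equation). Let $\theta\in\Theta$. For all $x_0\in\mathbb{R}^d$ and $u\in L^2([0,T],\mathbb{R}^d)$ there is a unique solution $X_{\theta,x_0,u}$ on $[0,T]$ of $$\dot x(t)=A_\theta(t)x(t)+r_\theta(t)+u(t),\qquad x(0)=x_0 .$$ Define the cost $$C(\zeta;u,x_0,\theta,\lambda)=x_0^{T}Qx_0+\int_0^T\left\{\|\zeta(t)-CX_{\theta,x_0,u}(t)\|_2^2+\lambda\|u(t)\|_2^2\right\}dt$$ and the profiled cost $S(\zeta;\theta,\lambda)=\inf_{x_0\in\mathbb{R}^d}\inf_{u\in L^2}C(\zeta;u,x_0,\theta,\lambda)$. Then: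 1. There is a unique pair consisting of an initial condition $\widehat{x_0}\in\mathbb{R}^d$ and a control $\bar u_{\theta,\lambda}\in L^2([0,T],\mathbb{R}^d)$ that minimizes $C(\zeta;u,x_0,\theta,\lambda)$ over all $(x_0,u)$. 2. The initial value problem $$\dot E_\theta=C^TC-A_\theta^TE_\theta-E_\theta A_\theta-\tfrac1\lambda E_\theta^2,\qquad E_\theta(0)=Q,$$ $$\dot h_\theta(t,\zeta)=-\alpha_\theta(t)h_\theta(t,\zeta)-\beta_\theta(t,\zeta),\qquad h_\theta(0,\zeta)=0,$$ with $\alpha_\theta(t)=A_\theta(t)^T+\frac{E_\theta(t)}{\lambda}$ and $\beta_\theta(t,\zeta)=C^T\zeta(t)+E_\theta(t)r_\theta(t)$, has a unique solution $(E_\theta,h_\theta)$ on $[0,T]$; the matrix $E_\theta(t)$ is symmetric for all $t\in[0,T]$, and $E_\theta(T)$ is nonsingular. 3. For almost every $t\in[0,T]$, $$\bar u_{\theta,\lambda}(t)=\frac1\lambda\left(E_\theta(t)X_{\theta,\widehat{x_0},\bar u_{\theta,\lambda}}(t)+h_\theta(t,\zeta)\right).$$ 4. The profiled cost has the closed form $$S(\zeta;\theta,\lambda)=\int_0^T\left(\|\zeta(t)\|_2^2-2r_\theta(t)^Th_\theta(t,\zeta)-\frac1\lambda\|h_\theta(t,\zeta)\|_2^2\right)dt-h_\theta(T,\zeta)^TE_\theta(T)^{-1}h_\theta(T,\zeta).$$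 5. The final state is $$X_{\theta,\widehat{x_0},\bar u_{\theta,\lambda}}(T)=-E_\theta(T)^{-1}h_\theta(T,\zeta).$$ -/

import Mathlib

open MeasureTheory Set
open scoped Matrix

noncomputable section

/-- Euclidean space `ℝⁿ` of column vectors. -/
abbrev Vec (n : ℕ) : Type := EuclideanSpace ℝ (Fin n)

/-- The matrix-vector product `M v` between Euclidean spaces. -/
def mulV {m n : ℕ} (M : Matrix (Fin m) (Fin n) ℝ) (v : Vec n) : Vec m :=
  WithLp.toLp 2 (M *ᵥ v.ofLp)

/-- Lebesgue measure on `[0, T]`. -/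
abbrev timeMeasure (T : ℝ) : Measure ℝ := volume.restrict (Icc (0 : ℝ) T)

/-- The space of controls `L²([0, T], ℝᵈ)` (functions up to almost everywhere equality). -/
abbrev Control (d : ℕ) (T : ℝ) : Type := Lp (Vec d) 2 (timeMeasure T)

/-- `X` solves `ẋ(t) = A(t) x(t) + r(t) + u(t)` on `[0, T]`, `x(0) = x₀`, in the Carathéodory sense:
`X` is continuous on `[0, T]` and is there the integral of the (integrable) right-hand side. -/
def IsControlledSolution {d : ℕ} (T : ℝ) (A : ℝ → Matrix (Fin d) (Fin d) ℝ) (r : ℝ → Vec d)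
    (x₀ : Vec d) (u : ℝ → Vec d) (X : ℝ → Vec d) : Prop :=
  ContinuousOn X (Icc 0 T) ∧
  IntervalIntegrable (fun s => mulV (A s) (X s) + r s + u s) volume 0 T ∧
  ∀ t ∈ Icc (0 : ℝ) T, X t = x₀ + ∫ s in (0 : ℝ)..t, (mulV (A s) (X s) + r s + u s)

open Classical in
/-- The trajectory `X_{x₀,u}` of the controlled equation (unique on `[0, T]` when it exists; the
value `0` is used if there is none). -/
def controlledState {d : ℕ} (T : ℝ) (A : ℝ → Matrix (Fin d) (Fin d) ℝ) (r : ℝ → Vec d)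
    (x₀ : Vec d) (u : Control d T) : ℝ → Vec d :=
  if h : ∃ X : ℝ → Vec d, IsControlledSolution T A r x₀ u X then h.choose else 0

/-- The cost
`x₀ᵀ Q x₀ + ∫₀ᵀ (‖ζ(t) - C X_{x₀,u}(t)‖² + lam ‖u(t)‖²) dt`. -/
def kalmanCost {d d' : ℕ} (T : ℝ) (A : ℝ → Matrix (Fin d) (Fin d) ℝ) (r : ℝ → Vec d)
    (C : Matrix (Fin d') (Fin d) ℝ) (Q : Matrix (Fin d) (Fin d) ℝ) (lam : ℝ)
    (ζ : ℝ → Vec d') (x₀ : Vec d) (u : Control d T) : ℝ :=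
  inner ℝ x₀ (mulV Q x₀) +
    ∫ t in (0 : ℝ)..T,
      (‖ζ t - mulV C (controlledState T A r x₀ u t)‖ ^ 2 + lam * ‖u t‖ ^ 2)

/-- The profiled cost `S = inf_{x₀} inf_{u ∈ L²} cost`. -/
def profiledCost {d d' : ℕ} (T : ℝ) (A : ℝ → Matrix (Fin d) (Fin d) ℝ) (r : ℝ → Vec d)
    (C : Matrix (Fin d') (Fin d) ℝ) (Q : Matrix (Fin d) (Fin d) ℝ) (lam : ℝ)
    (ζ : ℝ → Vec d') : ℝ :=
  ⨅ x₀ : Vec d, ⨅ u : Control d T, kalmanCost T A r C Q lam ζ x₀ u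

/-- `(x₀, u)` minimizes the cost over all initial conditions and all controls in `L²`. -/
def IsOptimalPair {d d' : ℕ} (T : ℝ) (A : ℝ → Matrix (Fin d) (Fin d) ℝ) (r : ℝ → Vec d)
    (C : Matrix (Fin d') (Fin d) ℝ) (Q : Matrix (Fin d) (Fin d) ℝ) (lam : ℝ)
    (ζ : ℝ → Vec d') (x₀ : Vec d) (u : Control d T) : Prop :=
  ∀ (y₀ : Vec d) (v : Control d T),
    kalmanCost T A r C Q lam ζ x₀ u ≤ kalmanCost T A r C Q lam ζ y₀ v

/-- The right-hand side `CᵀC - A(t)ᵀE - E A(t) - (1/lam) E²` of the Riccati equation. -/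
def riccatiField {d d' : ℕ} (A : ℝ → Matrix (Fin d) (Fin d) ℝ)
    (C : Matrix (Fin d') (Fin d) ℝ) (lam : ℝ) (E : Matrix (Fin d) (Fin d) ℝ) (t : ℝ) :
    Matrix (Fin d) (Fin d) ℝ :=
  Cᵀ * C - (A t)ᵀ * E - E * A t - (1 / lam) • (E * E)

/-- `E` solves the matrix Riccati equation on `[0, T]` with `E(0) = Q`, in the Carathéodory sense
(integrals of matrices are taken entrywise). -/
def IsRiccatiSolution {d d' : ℕ} (T : ℝ) (A : ℝ → Matrix (Fin d) (Fin d) ℝ)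
    (C : Matrix (Fin d') (Fin d) ℝ) (Q : Matrix (Fin d) (Fin d) ℝ) (lam : ℝ)
    (E : ℝ → Matrix (Fin d) (Fin d) ℝ) : Prop :=
  ContinuousOn E (Icc 0 T) ∧
  ∀ i j : Fin d,
    IntervalIntegrable (fun s => riccatiField A C lam (E s) s i j) volume 0 T ∧
    ∀ t ∈ Icc (0 : ℝ) T, E t i j = Q i j + ∫ s in (0 : ℝ)..t, riccatiField A C lam (E s) s i j

/-- `α(t) = A(t)ᵀ + E(t)/lam`. -/
def adjointAlpha {d : ℕ} (A : ℝ → Matrix (Fin d) (Fin d) ℝ) (lam : ℝ)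
    (E : ℝ → Matrix (Fin d) (Fin d) ℝ) (t : ℝ) : Matrix (Fin d) (Fin d) ℝ :=
  (A t)ᵀ + (1 / lam) • E t

/-- `β(t) = Cᵀζ(t) + E(t) r(t)`. -/
def adjointBeta {d d' : ℕ} (r : ℝ → Vec d) (C : Matrix (Fin d') (Fin d) ℝ)
    (ζ : ℝ → Vec d') (E : ℝ → Matrix (Fin d) (Fin d) ℝ) (t : ℝ) : Vec d :=
  mulV Cᵀ (ζ t) + mulV (E t) (r t)

/-- `h` solves `ḣ(t) = -α(t) h(t) - β(t)` on `[0, T]`, `h(0) = 0`, in the Carathéodory sense. -/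
def IsAdjointSolution {d d' : ℕ} (T : ℝ) (A : ℝ → Matrix (Fin d) (Fin d) ℝ) (r : ℝ → Vec d)
    (C : Matrix (Fin d') (Fin d) ℝ) (lam : ℝ) (ζ : ℝ → Vec d')
    (E : ℝ → Matrix (Fin d) (Fin d) ℝ) (h : ℝ → Vec d) : Prop :=
  ContinuousOn h (Icc 0 T) ∧
  IntervalIntegrable
    (fun s => -mulV (adjointAlpha A lam E s) (h s) - adjointBeta r C ζ E s) volume 0 T ∧
  ∀ t ∈ Icc (0 : ℝ) T,
    h t = ∫ s in (0 : ℝ)..t, (-mulV (adjointAlpha A lam E s) (h s) - adjointBeta r C ζ E s)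

end

/-!
The proof is a verification argument and uses no general optimal control theory.

*Square completion.* Let `E` solve the Riccati equation and `h` the adjoint equation. Along every
trajectory of the controlled equation, `xᵀ E x + 2 hᵀ x` has as derivative the running cost minus
`lam ‖u - (E x + h) / lam‖²` minus a function of time alone (`value_deriv_eq`). After integration
(`cost_eq_terminal_add_deviation`) and completion of the square at time `T` (`terminal_eq`), the
cost of `(x₀, u)` is the closed form of the profiled cost, plus
`(X(T) - x*)ᵀ E(T) (X(T) - x*)` with `x* = -E(T)⁻¹ h(T)`, plus `lam` times the squared `L²` distance
of `u` from the feedback law. Since `E(T)` is positive definite, the minimizers are exactly the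
feedback trajectories that end at `x*`. There is one and only one of them, because the closed loop
equation `ẋ = (A + E / lam) x + r + h / lam` can be solved from its terminal value
(`exists_closedLoop_of_terminal`, `closedLoop_eqOn_of_terminal_eq`).

*The Riccati equation.* Global existence comes from the linear Hamiltonian system
`Ż = A Z + Y / lam`, `Ẏ = CᵀC Z - Aᵀ Y`, `Z(0) = 1`, `Y(0) = Q`. The form `⟨Z v, Y v⟩` is
nondecreasing in time (`IsHamiltonianSolution.dotProduct_mulVec_le`) and starts at `vᵀ Q v`, so
`Z(t)` is invertible for all `t ∈ [0, T]` and `E = Y Z⁻¹` is defined and positive definite on all of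
`[0, T]`. It is symmetric because `Zᵀ Y - Yᵀ Z` is constant. Conversely, each Riccati solution
arises from the Hamiltonian system, which gives uniqueness. Moreover `Z` is the fundamental matrix
of the closed loop equation.

*Regularity.* The coefficients are only integrable in time. Calculus for Carathéodory solutions is
reduced to scalar primitives of integrable functions (`IsPrimitiveOn`), whose product rule and
exponential rule follow from the theory of absolutely continuous functions. Linear equations are
solved by a contraction in an exponentially weighted norm (`exists_isLinearSolution`); their
uniqueness is Gronwall's argument (`IsLinearSolution.eq_zero`).
-/

/-! ### Primitives of integrable functions -/

/-- `f` is, on `[0, T]`, a primitive of the integrable function `f'`: this is the scalar form of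
"`f` is a Carathéodory solution of `ḟ = f'`". -/
structure IsPrimitiveOn (T : ℝ) (f f' : ℝ → ℝ) : Prop where
  nonneg : 0 ≤ T
  intervalIntegrable : IntervalIntegrable f' volume 0 T
  eq_integral : ∀ t ∈ Icc 0 T, f t = f 0 + ∫ s in (0 : ℝ)..t, f' s

theorem IntervalIntegrable.mono_Icc {E : Type*} [NormedAddCommGroup E] {T t : ℝ} {f : ℝ → E}
    (hf : IntervalIntegrable f volume 0 T) (ht : t ∈ Icc 0 T) :
    IntervalIntegrable f volume 0 t :=
  hf.mono_set (by
    rw [uIcc_of_le ht.1, uIcc_of_le (ht.1.trans ht.2)]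
    exact Icc_subset_Icc_right ht.2)

theorem AbsolutelyContinuousOnInterval.lipschitzOnWith_comp {X Y : Type*} [PseudoMetricSpace X]
    [PseudoMetricSpace Y] {f : ℝ → X} {φ : X → Y} {a b : ℝ} {K : NNReal} {s : Set X}
    (hf : AbsolutelyContinuousOnInterval f a b) (hφ : LipschitzOnWith K φ s)
    (hs : MapsTo f (uIcc a b) s) :
    AbsolutelyContinuousOnInterval (φ ∘ f) a b := by
  unfold AbsolutelyContinuousOnInterval at hf ⊢
  have h0 := hf.const_mul (K : ℝ)
  rw [mul_zero] at h0
  refine squeeze_zero' (Filter.Eventually.of_forall fun E =>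
    Finset.sum_nonneg fun i _ => dist_nonneg) ?_ h0
  have : ∀ᶠ E in (AbsolutelyContinuousOnInterval.totalLengthFilter ⊓
      Filter.principal (AbsolutelyContinuousOnInterval.disjWithin a b)),
      E ∈ AbsolutelyContinuousOnInterval.disjWithin a b :=
    Filter.mem_inf_of_right (Filter.mem_principal_self _)
  filter_upwards [this] with E hE
  rw [Finset.mul_sum]
  refine Finset.sum_le_sum fun i hi => ?_
  exact hφ.dist_le_mul _ (hs (hE.1 i hi).1) _ (hs (hE.1 i hi).2)

namespace IsPrimitiveOn

variable {T : ℝ} {f f' g g' : ℝ → ℝ}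

theorem of_intervalIntegrable (hT : 0 ≤ T) (hg : IntervalIntegrable g volume 0 T) (a : ℝ) :
    IsPrimitiveOn T (fun t => a + ∫ s in (0 : ℝ)..t, g s) g :=
  ⟨hT, hg, fun t _ => by simp⟩

theorem congr (hf : IsPrimitiveOn T f f') (h : ∀ t ∈ Icc 0 T, f t = g t)
    (h' : ∀ t ∈ Icc 0 T, f' t = g' t) : IsPrimitiveOn T g g' := by
  have hT := hf.1
  refine ⟨hT, hf.2.congr ?_, fun t ht => ?_⟩
  · intro s hs
    rw [uIoc_of_le hT] at hs
    exact h' s ⟨hs.1.le, hs.2⟩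
  · rw [← h t ht, ← h 0 ⟨le_rfl, hT⟩, hf.3 t ht]
    congr 1
    refine intervalIntegral.integral_congr fun s hs => ?_
    rw [uIcc_of_le ht.1] at hs
    exact h' s ⟨hs.1, hs.2.trans ht.2⟩

theorem congr_deriv (hf : IsPrimitiveOn T f f') (h : ∀ t ∈ Icc 0 T, f' t = g' t) :
    IsPrimitiveOn T f g' :=
  hf.congr (fun _ _ => rfl) h

/-- A primitive in the sense of `IsPrimitiveOn` is, on `[0, T]`, an absolutely continuous function
whose derivative is almost everywhere the given one. -/
theorem exists_absolutelyContinuous (hf : IsPrimitiveOn T f f') :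
    ∃ F : ℝ → ℝ, AbsolutelyContinuousOnInterval F 0 T ∧
      (∀ᵐ x, x ∈ uIcc 0 T → HasDerivAt F (f' x) x) ∧ ∀ t ∈ Icc 0 T, F t = f t := by
  refine ⟨fun t => (∫ s in (0 : ℝ)..t, f' s) + f 0, ?_, ?_, fun t ht => ?_⟩
  · have h1 := hf.2.absolutelyContinuousOnInterval_intervalIntegral (c := 0) left_mem_uIcc
    exact h1.add (g := fun _ => f 0)
      ((LipschitzWith.const (f 0)).lipschitzOnWith.absolutelyContinuousOnInterval)
  · filter_upwards [hf.2.ae_hasDerivAt_integral] with x hx hxT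
    exact (hx hxT 0 left_mem_uIcc).add_const _
  · rw [hf.3 t ht, add_comm]

theorem of_absolutelyContinuous (hT : 0 ≤ T) (hf : AbsolutelyContinuousOnInterval f 0 T)
    (hd : ∀ᵐ x, x ∈ uIcc 0 T → HasDerivAt f (f' x) x) : IsPrimitiveOn T f f' := by
  refine ⟨hT, hf.intervalIntegrable_deriv.congr_ae ?_, fun t ht => ?_⟩
  · rw [Filter.EventuallyEq, ae_restrict_iff' measurableSet_uIoc]
    filter_upwards [hd] with x hx hxT
    exact (hx (uIoc_subset_uIcc hxT)).deriv
  · have hsub : uIcc 0 t ⊆ uIcc 0 T := by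
      rw [uIcc_of_le ht.1, uIcc_of_le hT]
      exact Icc_subset_Icc_right ht.2
    have h1 := (hf.mono hsub).integral_deriv_eq_sub
    rw [← sub_eq_iff_eq_add', ← h1]
    refine intervalIntegral.integral_congr_ae ?_
    filter_upwards [hd] with x hx hxT
    exact (hx (hsub (uIoc_subset_uIcc hxT))).deriv

theorem continuousOn (hf : IsPrimitiveOn T f f') : ContinuousOn f (Icc 0 T) := by
  obtain ⟨F, hF, -, h⟩ := hf.exists_absolutelyContinuous
  have := hF.continuousOn
  rw [uIcc_of_le hf.1] at this
  exact this.congr fun t ht => (h t ht).symm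

theorem const (hT : 0 ≤ T) (a : ℝ) : IsPrimitiveOn T (fun _ => a) (fun _ => 0) :=
  ⟨hT, by simp, by simp⟩

theorem add (hf : IsPrimitiveOn T f f') (hg : IsPrimitiveOn T g g') :
    IsPrimitiveOn T (fun t => f t + g t) (fun t => f' t + g' t) := by
  refine ⟨hf.1, hf.2.add hg.2, fun t ht => ?_⟩
  rw [intervalIntegral.integral_add (hf.2.mono_Icc ht) (hg.2.mono_Icc ht), hf.3 t ht, hg.3 t ht]
  ring

theorem const_mul (c : ℝ) (hf : IsPrimitiveOn T f f') :
    IsPrimitiveOn T (fun t => c * f t) (fun t => c * f' t) := by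
  refine ⟨hf.1, hf.2.const_mul c, fun t ht => ?_⟩
  rw [intervalIntegral.integral_const_mul, hf.3 t ht]
  ring

theorem neg (hf : IsPrimitiveOn T f f') :
    IsPrimitiveOn T (fun t => -f t) (fun t => -f' t) := by
  simpa using hf.const_mul (-1)

theorem sub (hf : IsPrimitiveOn T f f') (hg : IsPrimitiveOn T g g') :
    IsPrimitiveOn T (fun t => f t - g t) (fun t => f' t - g' t) := by
  simpa only [sub_eq_add_neg] using hf.add hg.neg

theorem mul (hf : IsPrimitiveOn T f f') (hg : IsPrimitiveOn T g g') :
    IsPrimitiveOn T (fun t => f t * g t) (fun t => f' t * g t + f t * g' t) := by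
  obtain ⟨F, hF, hFd, hFf⟩ := hf.exists_absolutelyContinuous
  obtain ⟨G, hG, hGd, hGg⟩ := hg.exists_absolutelyContinuous
  have h : IsPrimitiveOn T (fun t => F t * G t) (fun t => f' t * G t + F t * g' t) := by
    refine of_absolutelyContinuous hf.1 (hF.fun_mul hG) ?_
    filter_upwards [hFd, hGd] with x hx hy hxT
    exact (hx hxT).mul (hy hxT)
  refine h.congr (fun t ht => by rw [hFf t ht, hGg t ht]) fun t ht => by
    rw [hFf t ht, hGg t ht]

theorem exp (hf : IsPrimitiveOn T f f') :
    IsPrimitiveOn T (fun t => Real.exp (f t)) (fun t => Real.exp (f t) * f' t) := by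
  obtain ⟨F, hF, hFd, hFf⟩ := hf.exists_absolutelyContinuous
  have h : IsPrimitiveOn T (fun t => Real.exp (F t)) (fun t => Real.exp (F t) * f' t) := by
    refine of_absolutelyContinuous hf.1 ?_ ?_
    · obtain ⟨C, hC⟩ := hF.exists_bound
      have hlip : LipschitzOnWith (Real.toNNReal (Real.exp C)) Real.exp (Iic C) := by
        refine (convex_Iic C).lipschitzOnWith_of_nnnorm_deriv_le
          (fun x _ => Real.differentiableAt_exp) fun x hx => ?_
        rw [Real.deriv_exp, ← NNReal.coe_le_coe, coe_nnnorm, Real.norm_eq_abs, Real.abs_exp,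
          Real.coe_toNNReal _ (Real.exp_pos C).le]
        exact Real.exp_le_exp.2 hx
      have hac : AbsolutelyContinuousOnInterval (Real.exp ∘ F) 0 T :=
        hF.lipschitzOnWith_comp hlip fun x hx =>
          (le_abs_self (F x)).trans (by simpa using hC x hx)
      exact hac
    · filter_upwards [hFd] with x hx hxT
      exact (hx hxT).exp
  exact h.congr (fun t ht => by rw [hFf t ht]) fun t ht => by rw [hFf t ht]

theorem sum {ι : Type*} {s : Finset ι} {f f' : ι → ℝ → ℝ} (hT : 0 ≤ T)
    (h : ∀ i ∈ s, IsPrimitiveOn T (f i) (f' i)) :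
    IsPrimitiveOn T (fun t => ∑ i ∈ s, f i t) (fun t => ∑ i ∈ s, f' i t) := by
  classical
  induction s using Finset.induction_on with
  | empty => simpa using const hT 0
  | insert i s hi ih =>
    simp only [Finset.sum_insert hi]
    exact (h i (Finset.mem_insert_self i s)).add
      (ih fun j hj => h j (Finset.mem_insert_of_mem hj))

theorem dotProduct {ι : Type*} [Fintype ι] {x x' y y' : ℝ → ι → ℝ} (hT : 0 ≤ T)
    (hx : ∀ i, IsPrimitiveOn T (fun t => x t i) (fun t => x' t i))
    (hy : ∀ i, IsPrimitiveOn T (fun t => y t i) (fun t => y' t i)) :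
    IsPrimitiveOn T (fun t => x t ⬝ᵥ y t) (fun t => x' t ⬝ᵥ y t + x t ⬝ᵥ y' t) := by
  have := sum (s := Finset.univ) hT fun i _ => (hx i).mul (hy i)
  simpa only [Finset.sum_add_distrib, _root_.dotProduct] using this

theorem apply_le_of_deriv_nonpos (hf : IsPrimitiveOn T f f') (h : ∀ t ∈ Icc 0 T, f' t ≤ 0) :
    ∀ t ∈ Icc 0 T, f t ≤ f 0 := by
  intro t ht
  rw [hf.3 t ht]
  have : ∫ s in (0 : ℝ)..t, f' s ≤ 0 := by
    rw [← neg_nonneg, ← intervalIntegral.integral_neg]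
    exact intervalIntegral.integral_nonneg ht.1 fun s hs =>
      neg_nonneg.2 (h s ⟨hs.1, hs.2.trans ht.2⟩)
  linarith

end IsPrimitiveOn

/-! ### Linear differential equations with integrable coefficients -/

/-- `x` is a Carathéodory solution of the linear system `ẋ = M x + b` on `[0, T]`, componentwise. -/
def IsLinearSolution {ι : Type*} [Fintype ι] (T : ℝ) (M : ℝ → Matrix ι ι ℝ) (b : ℝ → ι → ℝ)
    (x : ℝ → ι → ℝ) : Prop :=
  ∀ i, IsPrimitiveOn T (fun t => x t i) (fun t => (M t *ᵥ x t + b t) i)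

section LinearODE

variable {ι : Type*} [Fintype ι] {T : ℝ} {M : ℝ → Matrix ι ι ℝ} {b : ℝ → ι → ℝ}

theorem IntervalIntegrable.sum_abs
    (hM : ∀ i j, IntervalIntegrable (fun t => M t i j) volume 0 T) :
    IntervalIntegrable (fun t => ∑ i, ∑ j, |M t i j|) volume 0 T := by
  have : (fun t => ∑ i, ∑ j, |M t i j|) = ∑ i, ∑ j, fun t => |M t i j| := by
    ext t
    simp
  rw [this]
  exact IntervalIntegrable.sum _ fun i _ => IntervalIntegrable.sum _ fun j _ => (hM i j).abs

theorem Matrix.abs_dotProduct_mulVec_le (M : Matrix ι ι ℝ) (v : ι → ℝ) :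
    |v ⬝ᵥ M *ᵥ v| ≤ (∑ i, ∑ j, |M i j|) * (v ⬝ᵥ v) := by
  have hsq : ∀ i, v i ^ 2 ≤ v ⬝ᵥ v := fun i => by
    rw [sq]
    exact Finset.single_le_sum (f := fun i => v i * v i) (fun j _ => mul_self_nonneg _)
      (Finset.mem_univ i)
  have hexp : v ⬝ᵥ M *ᵥ v = ∑ i, ∑ j, v i * (M i j * v j) := by
    simp only [dotProduct, Matrix.mulVec, Finset.mul_sum]
  rw [hexp]
  simp only [Finset.sum_mul]
  refine (Finset.abs_sum_le_sum_abs _ _).trans (Finset.sum_le_sum fun i _ => ?_)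
  refine (Finset.abs_sum_le_sum_abs _ _).trans (Finset.sum_le_sum fun j _ => ?_)
  have h1 := hsq i
  have h2 := hsq j
  have h3 : |v i| * |v j| ≤ v ⬝ᵥ v := by
    rw [← sq_abs] at h1 h2
    nlinarith [sq_nonneg (|v i| - |v j|)]
  calc |v i * (M i j * v j)| = |M i j| * (|v i| * |v j|) := by
        rw [abs_mul, abs_mul]; ring
    _ ≤ |M i j| * (v ⬝ᵥ v) := mul_le_mul_of_nonneg_left h3 (abs_nonneg _)

theorem Matrix.norm_mulVec_le_sum_abs (M : Matrix ι ι ℝ) (v : ι → ℝ) :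
    ‖M *ᵥ v‖ ≤ (∑ i, ∑ j, |M i j|) * ‖v‖ := by
  have hnn : ∀ i, 0 ≤ ∑ j, |M i j| := fun i => Finset.sum_nonneg fun j _ => abs_nonneg _
  refine (pi_norm_le_iff_of_nonneg
    (mul_nonneg (Finset.sum_nonneg fun i _ => hnn i) (norm_nonneg _))).2 fun i => ?_
  calc ‖(M *ᵥ v) i‖ ≤ ∑ j, ‖M i j * v j‖ := norm_sum_le _ _
    _ ≤ ∑ j, |M i j| * ‖v‖ := Finset.sum_le_sum fun j _ => by
        rw [norm_mul]
        exact mul_le_mul_of_nonneg_left (norm_le_pi_norm v j) (abs_nonneg _)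
    _ = (∑ j, |M i j|) * ‖v‖ := (Finset.sum_mul _ _ _).symm
    _ ≤ _ := mul_le_mul_of_nonneg_right
        (Finset.single_le_sum (f := fun i => ∑ j, |M i j|) (fun i _ => hnn i)
          (Finset.mem_univ i)) (norm_nonneg _)

theorem IsLinearSolution.sub {b' : ℝ → ι → ℝ} {x y : ℝ → ι → ℝ} (hx : IsLinearSolution T M b x)
    (hy : IsLinearSolution T M b' y) : IsLinearSolution T M (b - b') (x - y) := fun i =>
  ((hx i).sub (hy i)).congr_deriv fun t _ => by
    simp only [Pi.add_apply, Pi.sub_apply, Matrix.mulVec_sub]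
    ring

theorem IsLinearSolution.add {b' : ℝ → ι → ℝ} {x y : ℝ → ι → ℝ} (hx : IsLinearSolution T M b x)
    (hy : IsLinearSolution T M b' y) : IsLinearSolution T M (b + b') (x + y) := fun i =>
  ((hx i).add (hy i)).congr_deriv fun t _ => by
    simp only [Pi.add_apply, Matrix.mulVec_add]
    ring

/-- Gronwall's argument: `exp (-2 ∫₀ᵗ ∑ |M i j|) |x(t)|²` does not increase. -/
theorem IsLinearSolution.eq_zero {x : ℝ → ι → ℝ} (hT : 0 ≤ T)
    (hM : ∀ i j, IntervalIntegrable (fun t => M t i j) volume 0 T)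
    (hx : IsLinearSolution T M 0 x) (h0 : x 0 = 0) : ∀ t ∈ Icc 0 T, x t = 0 := by
  have hm := IsPrimitiveOn.of_intervalIntegrable hT (IntervalIntegrable.sum_abs hM) 0
  have hw := ((hm.const_mul (-2)).exp).mul (IsPrimitiveOn.dotProduct hT hx hx)
  intro t ht
  have h := hw.apply_le_of_deriv_nonpos (fun s hs => ?_) t ht
  · rw [h0, dotProduct_zero, mul_zero] at h
    have h1 := nonpos_of_mul_nonpos_right h (Real.exp_pos _)
    have h2 : 0 ≤ x t ⬝ᵥ x t := Finset.sum_nonneg fun i _ => mul_self_nonneg _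
    exact dotProduct_self_eq_zero.1 (le_antisymm h1 h2)
  · have h1 := (le_abs_self _).trans (Matrix.abs_dotProduct_mulVec_le (M s) (x s))
    simp only [Pi.zero_apply, add_zero]
    have h3 : (M s *ᵥ x s) ⬝ᵥ x s = x s ⬝ᵥ M s *ᵥ x s := dotProduct_comm _ _
    rw [h3]
    set e := Real.exp (-2 * (0 + ∫ s in (0 : ℝ)..s, ∑ i, ∑ j, |M s i j|))
    have he : 0 < e := Real.exp_pos _
    nlinarith

theorem IsLinearSolution.eqOn {x y : ℝ → ι → ℝ} (hT : 0 ≤ T)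
    (hM : ∀ i j, IntervalIntegrable (fun t => M t i j) volume 0 T)
    (hx : IsLinearSolution T M b x) (hy : IsLinearSolution T M b y) (h0 : x 0 = y 0) :
    ∀ t ∈ Icc 0 T, x t = y t := by
  have h := hx.sub hy
  rw [sub_self] at h
  intro t ht
  exact sub_eq_zero.1 (h.eq_zero hT hM (by simp [h0]) t ht)

/-- Existence for linear systems with integrable coefficients: the substitution
`x = exp (2 m) y`, `m(t) = ∫₀ᵗ ∑ |M i j|`, turns the integral equation into the fixed point equation
of a contraction of `C([0, T])` with constant `1/2`. -/
theorem exists_isLinearSolution (hT : 0 ≤ T)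
    (hM : ∀ i j, IntervalIntegrable (fun t => M t i j) volume 0 T)
    (hb : ∀ i, IntervalIntegrable (fun t => b t i) volume 0 T) (x₀ : ι → ℝ) :
    ∃ x : ℝ → ι → ℝ, x 0 = x₀ ∧ IsLinearSolution T M b x := by
  set k : ℝ → ℝ := fun t => ∑ i, ∑ j, |M t i j| with hk
  have hk0 : ∀ t, 0 ≤ k t := fun t =>
    Finset.sum_nonneg fun i _ => Finset.sum_nonneg fun j _ => abs_nonneg _
  have hkint : IntervalIntegrable k volume 0 T := IntervalIntegrable.sum_abs hM
  set m : ℝ → ℝ := fun t => ∫ s in (0 : ℝ)..t, k s with hm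
  have hmp : IsPrimitiveOn T m k := by
    simpa using IsPrimitiveOn.of_intervalIntegrable hT hkint 0
  have hm0 : m 0 = 0 := by simp [hm]
  have hmc : ContinuousOn m (Icc 0 T) := hmp.continuousOn
  have hep := (hmp.const_mul 2).exp
  have hec : ContinuousOn (fun t => Real.exp (2 * m t)) (Icc 0 T) := hep.continuousOn
  -- Elements of `C([0, T])` are extended to `ℝ` through the projection `p` onto `[0, T]`.
  let p : ℝ → Icc (0 : ℝ) T := projIcc 0 T hT
  have hp : ∀ t (ht : t ∈ Icc 0 T), p t = ⟨t, ht⟩ := fun t ht => projIcc_of_mem hT ht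
  have hpc : Continuous p := continuous_projIcc
  let F : C(Icc (0 : ℝ) T, ι → ℝ) → ℝ → ι → ℝ :=
    fun y s => M s *ᵥ (Real.exp (2 * m s) • y (p s)) + b s
  have hFint : ∀ y, IntervalIntegrable (F y) volume 0 T := by
    intro y
    have : ∀ i, IntervalIntegrable (fun s => F y s i) volume 0 T := by
      intro i
      have h1 : IntervalIntegrable
          (∑ j, fun s => M s i j * (Real.exp (2 * m s) * y (p s) j)) volume 0 T := by
        refine IntervalIntegrable.sum _ fun j _ => (hM i j).mul_continuousOn ?_
        rw [uIcc_of_le hT]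
        refine hec.mul (Continuous.continuousOn ?_)
        fun_prop
      refine (h1.add (hb i)).congr fun s _ => ?_
      simp [F, Matrix.mulVec, dotProduct]
    rw [intervalIntegrable_iff]
    refine Integrable.of_eval fun i => ?_
    exact (intervalIntegrable_iff.1 (this i))
  have hcont : ∀ y, ContinuousOn
      (fun t => Real.exp (-(2 * m t)) • (x₀ + ∫ s in (0 : ℝ)..t, F y s)) (Icc 0 T) := by
    intro y
    have h1 : ContinuousOn (fun t => ∫ s in (0 : ℝ)..t, F y s) (Icc 0 T) := by
      have := intervalIntegral.continuousOn_primitive_interval (μ := volume) (f := F y)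
        (a := 0) (b := T) ((intervalIntegrable_iff' (by finiteness)).1 (hFint y))
      rwa [uIcc_of_le hT] at this
    exact (Real.continuous_exp.comp_continuousOn (continuousOn_const.mul hmc).neg).smul
      (continuousOn_const.add h1)
  let Φ : C(Icc (0 : ℝ) T, ι → ℝ) → C(Icc (0 : ℝ) T, ι → ℝ) := fun y =>
    ⟨fun t => Real.exp (-(2 * m t)) • (x₀ + ∫ s in (0 : ℝ)..t, F y s),
      continuousOn_iff_continuous_domRestrict.1 (hcont y)⟩
  have hΦ : ContractingWith (1 / 2) Φ := by
    refine ⟨by rw [← NNReal.coe_lt_coe]; norm_num, LipschitzWith.of_dist_le_mul fun y z => ?_⟩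
    rw [ContinuousMap.dist_le (by positivity)]
    rintro ⟨t, ht⟩
    have hI : ‖∫ s in (0 : ℝ)..t, (F y s - F z s)‖ ≤
        ∫ s in (0 : ℝ)..t, (Real.exp (2 * m s) * (2 * k s)) * (dist y z / 2) := by
      refine intervalIntegral.norm_integral_le_of_norm_le ht.1
        (Filter.Eventually.of_forall fun s hs => ?_) ((hep.2.mono_Icc ht).mul_const _)
      have h1 : F y s - F z s = M s *ᵥ (Real.exp (2 * m s) • (y (p s) - z (p s))) := by
        simp only [F, smul_sub, Matrix.mulVec_sub]
        abel
      rw [h1]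
      refine (Matrix.norm_mulVec_le_sum_abs _ _).trans ?_
      rw [norm_smul, Real.norm_eq_abs, Real.abs_exp, ← dist_eq_norm]
      have h2 : dist (y (p s)) (z (p s)) ≤ dist y z := ContinuousMap.dist_apply_le_dist _
      have h3 : 0 ≤ k s * Real.exp (2 * m s) := mul_nonneg (hk0 s) (Real.exp_pos _).le
      have h4 := mul_le_mul_of_nonneg_left h2 h3
      calc _ = k s * Real.exp (2 * m s) * dist (y (p s)) (z (p s)) := by rw [hk]; ring
        _ ≤ _ := h4
        _ = _ := by ring
    have he : ∫ s in (0 : ℝ)..t, Real.exp (2 * m s) * (2 * k s) = Real.exp (2 * m t) - 1 := by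
      have := hep.3 t ht
      rw [hm0, mul_zero, Real.exp_zero] at this
      linarith
    rw [intervalIntegral.integral_mul_const, he] at hI
    have h1 : Φ y ⟨t, ht⟩ - Φ z ⟨t, ht⟩ =
        Real.exp (-(2 * m t)) • ∫ s in (0 : ℝ)..t, (F y s - F z s) := by
      rw [intervalIntegral.integral_sub ((hFint y).mono_Icc ht) ((hFint z).mono_Icc ht)]
      simp only [Φ, ContinuousMap.coe_mk, smul_add, smul_sub]
      abel
    rw [dist_eq_norm, h1, norm_smul, Real.norm_eq_abs, Real.abs_exp]
    have h5 : Real.exp (-(2 * m t)) * Real.exp (2 * m t) = 1 := by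
      rw [← Real.exp_add]; simp
    have h6 := mul_le_mul_of_nonneg_left hI (Real.exp_pos (-(2 * m t))).le
    have h7 : 0 ≤ Real.exp (-(2 * m t)) * dist y z :=
      mul_nonneg (Real.exp_pos _).le dist_nonneg
    have h8 : Real.exp (-(2 * m t)) * ((Real.exp (2 * m t) - 1) * (dist y z / 2)) =
        dist y z / 2 - Real.exp (-(2 * m t)) * dist y z / 2 := by
      linear_combination (dist y z / 2) * h5
    have h9 : ((1 / 2 : NNReal) : ℝ) = 1 / 2 := by norm_num
    rw [h9]
    linarith
  have hne : Nonempty C(Icc (0 : ℝ) T, ι → ℝ) := ⟨0⟩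
  obtain ⟨y, hy⟩ : ∃ y, Φ y = y := ⟨_, hΦ.fixedPoint_isFixedPt⟩
  have hyt : ∀ t ∈ Icc 0 T, Real.exp (2 * m t) • y (p t) = x₀ + ∫ s in (0 : ℝ)..t, F y s := by
    intro t ht
    have h1 : y ⟨t, ht⟩ = Real.exp (-(2 * m t)) • (x₀ + ∫ s in (0 : ℝ)..t, F y s) :=
      (congrArg (fun f : C(Icc (0 : ℝ) T, ι → ℝ) => f ⟨t, ht⟩) hy).symm
    rw [hp t ht, h1, smul_smul, ← Real.exp_add, add_neg_cancel, Real.exp_zero, one_smul]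
  refine ⟨fun t => Real.exp (2 * m t) • y (p t), ?_, fun i => ?_⟩
  · refine (hyt 0 ⟨le_rfl, hT⟩).trans ?_
    simp
  · have hFi : ∀ j, IntervalIntegrable (fun s => F y s j) volume 0 T := fun j =>
      intervalIntegrable_iff.2 ((intervalIntegrable_iff.1 (hFint y)).eval j)
    refine (IsPrimitiveOn.of_intervalIntegrable hT (hFi i) (x₀ i)).congr (fun t ht => ?_)
      fun t _ => rfl
    refine Eq.trans ?_ (congrFun (hyt t ht) i).symm
    rw [Pi.add_apply, intervalIntegral.integral_of_le ht.1,
      intervalIntegral.integral_of_le ht.1, eval_integral]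
    intro j
    exact ((intervalIntegrable_iff_integrableOn_Ioc_of_le ht.1).1 ((hFi j).mono_Icc ht))

end LinearODE

/-! ### Matrix-valued primitives and linear matrix equations -/

/-- Entrywise form of `IsPrimitiveOn` for matrix-valued functions. -/
def IsMatrixPrimitiveOn {ι κ : Type*} (T : ℝ) (X X' : ℝ → Matrix ι κ ℝ) : Prop :=
  ∀ i j, IsPrimitiveOn T (fun t => X t i j) (fun t => X' t i j)

namespace IsMatrixPrimitiveOn

variable {ι κ l : Type*} {T : ℝ} {X X' : ℝ → Matrix ι κ ℝ}

theorem congr_deriv {X'' : ℝ → Matrix ι κ ℝ} (h : IsMatrixPrimitiveOn T X X')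
    (h' : ∀ t ∈ Icc 0 T, X' t = X'' t) : IsMatrixPrimitiveOn T X X'' := fun i j =>
  (h i j).congr_deriv fun t ht => by rw [h' t ht]

theorem congr {Y Y' : ℝ → Matrix ι κ ℝ} (h : IsMatrixPrimitiveOn T X X')
    (h₀ : ∀ t ∈ Icc 0 T, X t = Y t) (h₁ : ∀ t ∈ Icc 0 T, X' t = Y' t) :
    IsMatrixPrimitiveOn T Y Y' := fun i j =>
  (h i j).congr (fun t ht => by rw [h₀ t ht]) fun t ht => by rw [h₁ t ht]

theorem transpose (h : IsMatrixPrimitiveOn T X X') :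
    IsMatrixPrimitiveOn T (fun t => (X t)ᵀ) (fun t => (X' t)ᵀ) := fun i j => h j i

theorem sub {Y Y' : ℝ → Matrix ι κ ℝ} (h : IsMatrixPrimitiveOn T X X')
    (h' : IsMatrixPrimitiveOn T Y Y') :
    IsMatrixPrimitiveOn T (fun t => X t - Y t) (fun t => X' t - Y' t) := fun i j =>
  (h i j).sub (h' i j)

theorem mul [Fintype κ] {Y Y' : ℝ → Matrix κ l ℝ} (hT : 0 ≤ T) (h : IsMatrixPrimitiveOn T X X')
    (h' : IsMatrixPrimitiveOn T Y Y') :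
    IsMatrixPrimitiveOn T (fun t => X t * Y t) (fun t => X' t * Y t + X t * Y' t) := fun i j =>
  IsPrimitiveOn.dotProduct hT (fun k => h i k) (fun k => h' k j)

theorem mulVec [Fintype κ] {v v' : ℝ → κ → ℝ} (hT : 0 ≤ T) (h : IsMatrixPrimitiveOn T X X')
    (h' : ∀ k, IsPrimitiveOn T (fun t => v t k) (fun t => v' t k)) (i : ι) :
    IsPrimitiveOn T (fun t => (X t *ᵥ v t) i) (fun t => (X' t *ᵥ v t + X t *ᵥ v' t) i) :=
  IsPrimitiveOn.dotProduct hT (fun k => h i k) h'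

theorem mulVec_const [Fintype κ] (hT : 0 ≤ T) (h : IsMatrixPrimitiveOn T X X') (v : κ → ℝ)
    (i : ι) : IsPrimitiveOn T (fun t => (X t *ᵥ v) i) (fun t => (X' t *ᵥ v) i) :=
  (h.mulVec hT (fun k => IsPrimitiveOn.const hT (v k)) i).congr_deriv fun t _ => by
    have : (fun _ : κ => (0 : ℝ)) = 0 := rfl
    simp [this]

theorem eq_of_deriv_eq_zero (h : IsMatrixPrimitiveOn T X X') (h' : ∀ t ∈ Icc 0 T, X' t = 0) :
    ∀ t ∈ Icc 0 T, X t = X 0 := by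
  intro t ht
  ext i j
  have := ((h.congr_deriv (X'' := fun _ => 0) h') i j).3 t ht
  simpa using this

end IsMatrixPrimitiveOn

section LinearMatrixODE

variable {ι κ : Type*} [Fintype ι] {T : ℝ} {M : ℝ → Matrix ι ι ℝ}

theorem exists_isMatrixPrimitiveOn_mul (hT : 0 ≤ T)
    (hM : ∀ i j, IntervalIntegrable (fun t => M t i j) volume 0 T) (W₀ : Matrix ι κ ℝ) :
    ∃ W : ℝ → Matrix ι κ ℝ, W 0 = W₀ ∧ IsMatrixPrimitiveOn T W (fun t => M t * W t) := by
  choose x hx0 hx using fun j : κ =>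
    exists_isLinearSolution (b := 0) hT hM (by simp) (fun i => W₀ i j)
  refine ⟨fun t => Matrix.of fun i j => x j t i, ?_, fun i j => ?_⟩
  · ext i j
    simp [hx0]
  · refine (hx j i).congr_deriv fun t _ => ?_
    simp [Matrix.mulVec, Matrix.mul_apply, dotProduct]

theorem IsMatrixPrimitiveOn.eq_of_mul {W W' : ℝ → Matrix ι κ ℝ} (hT : 0 ≤ T)
    (hM : ∀ i j, IntervalIntegrable (fun t => M t i j) volume 0 T)
    (hW : IsMatrixPrimitiveOn T W (fun t => M t * W t))
    (hW' : IsMatrixPrimitiveOn T W' (fun t => M t * W' t)) (h0 : W 0 = W' 0) :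
    ∀ t ∈ Icc 0 T, W t = W' t := by
  have key : ∀ {V : ℝ → Matrix ι κ ℝ}, IsMatrixPrimitiveOn T V (fun t => M t * V t) →
      ∀ j, IsLinearSolution T M 0 (fun t i => V t i j) := fun hV j i =>
    (hV i j).congr_deriv fun t _ => by
      simp [Matrix.mulVec, Matrix.mul_apply, dotProduct]
  intro t ht
  ext i j
  exact congrFun ((key hW j).eqOn hT hM (key hW' j) (by simp [h0]) t ht) i

end LinearMatrixODE

theorem Matrix.continuousOn_inv {n : Type*} [Fintype n] [DecidableEq n] {s : Set ℝ}
    {Z : ℝ → Matrix n n ℝ} (hZ : ContinuousOn Z s) (hdet : ∀ t ∈ s, (Z t).det ≠ 0) :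
    ContinuousOn (fun t => (Z t)⁻¹) s := by
  have h1 : ContinuousOn (fun t => (Z t).det) s :=
    (continuous_id.matrix_det).comp_continuousOn hZ
  have h2 : ContinuousOn (fun t => (Z t).adjugate) s :=
    (continuous_id.matrix_adjugate).comp_continuousOn hZ
  have h3 : ∀ t, (Z t)⁻¹ = ((Z t).det)⁻¹ • (Z t).adjugate := fun t => by
    rw [Matrix.inv_def, Ring.inverse_eq_inv']
  simp only [h3]
  exact (h1.inv₀ hdet).smul h2

/-! ### The Riccati equation through its Hamiltonian system -/

section Riccati

variable {n m : Type*} [Fintype n] [DecidableEq n] [Fintype m] {T lam : ℝ}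
  {A : ℝ → Matrix n n ℝ} {C : Matrix m n ℝ} {Q : Matrix n n ℝ} {Z Y : ℝ → Matrix n n ℝ}

/-- The linear Hamiltonian system `Ż = A Z + Y / lam`, `Ẏ = CᵀC Z - Aᵀ Y` with `Z(0) = 1`,
`Y(0) = Q`, whose quotient `Y Z⁻¹` solves the Riccati equation. -/
structure IsHamiltonianSolution (T lam : ℝ) (A : ℝ → Matrix n n ℝ) (C : Matrix m n ℝ)
    (Q : Matrix n n ℝ) (Z Y : ℝ → Matrix n n ℝ) : Prop where
  init_fst : Z 0 = 1
  init_snd : Y 0 = Q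
  deriv_fst : IsMatrixPrimitiveOn T Z (fun t => A t * Z t + (1 / lam) • Y t)
  deriv_snd : IsMatrixPrimitiveOn T Y (fun t => Cᵀ * C * Z t - (A t)ᵀ * Y t)

/-- The coefficient matrix of the Hamiltonian system. -/
noncomputable def hamiltonianMatrix (lam : ℝ) (A : ℝ → Matrix n n ℝ) (C : Matrix m n ℝ) (t : ℝ) :
    Matrix (n ⊕ n) (n ⊕ n) ℝ :=
  Matrix.fromBlocks (A t) ((1 / lam) • 1) (Cᵀ * C) (-(A t)ᵀ)

theorem intervalIntegrable_hamiltonianMatrix {k : Type*} [DecidableEq k] {A : ℝ → Matrix k k ℝ}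
    {C : Matrix m k ℝ} (hA : ∀ i j, IntervalIntegrable (fun t => A t i j) volume 0 T)
    (i j : k ⊕ k) :
    IntervalIntegrable (fun t => hamiltonianMatrix lam A C t i j) volume 0 T := by
  rcases i with i | i <;> rcases j with j | j <;>
    simp only [hamiltonianMatrix, Matrix.fromBlocks_apply₁₁, Matrix.fromBlocks_apply₁₂,
      Matrix.fromBlocks_apply₂₁, Matrix.fromBlocks_apply₂₂]
  · exact hA i j
  · exact intervalIntegrable_const
  · exact intervalIntegrable_const
  · exact (hA j i).neg

theorem exists_isHamiltonianSolution (hT : 0 ≤ T)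
    (hA : ∀ i j, IntervalIntegrable (fun t => A t i j) volume 0 T) :
    ∃ Z Y, IsHamiltonianSolution T lam A C Q Z Y := by
  obtain ⟨W, hW0, hW⟩ := exists_isMatrixPrimitiveOn_mul hT
    (intervalIntegrable_hamiltonianMatrix (lam := lam) (C := C) hA) (Matrix.fromRows 1 Q)
  have hmul : ∀ t, hamiltonianMatrix lam A C t * W t = Matrix.fromRows
      (A t * (W t).toRows₁ + (1 / lam) • (W t).toRows₂)
      (Cᵀ * C * (W t).toRows₁ - (A t)ᵀ * (W t).toRows₂) := by
    intro t
    conv_lhs => rw [← Matrix.fromRows_toRows (W t)]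
    rw [hamiltonianMatrix, Matrix.fromBlocks_mul_fromRows]
    simp [sub_eq_add_neg]
  refine ⟨fun t => (W t).toRows₁, fun t => (W t).toRows₂, by simp [hW0], by simp [hW0],
    fun i j => ?_, fun i j => ?_⟩
  · refine (hW (Sum.inl i) j).congr_deriv fun t _ => ?_
    simp [hmul]
  · refine (hW (Sum.inr i) j).congr_deriv fun t _ => ?_
    simp [hmul]

namespace IsHamiltonianSolution

theorem unique {Z' Y' : ℝ → Matrix n n ℝ} (hT : 0 ≤ T)
    (hA : ∀ i j, IntervalIntegrable (fun t => A t i j) volume 0 T)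
    (h : IsHamiltonianSolution T lam A C Q Z Y) (h' : IsHamiltonianSolution T lam A C Q Z' Y') :
    ∀ t ∈ Icc 0 T, Z t = Z' t ∧ Y t = Y' t := by
  have key : ∀ {Z Y}, IsHamiltonianSolution T lam A C Q Z Y →
      IsMatrixPrimitiveOn T (fun t => Matrix.fromRows (Z t) (Y t))
        (fun t => hamiltonianMatrix lam A C t * Matrix.fromRows (Z t) (Y t)) := by
    intro Z Y h i j
    have hmul : ∀ t, hamiltonianMatrix lam A C t * Matrix.fromRows (Z t) (Y t) = Matrix.fromRows
        (A t * Z t + (1 / lam) • Y t) (Cᵀ * C * Z t - (A t)ᵀ * Y t) := by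
      intro t
      rw [hamiltonianMatrix, Matrix.fromBlocks_mul_fromRows]
      simp [sub_eq_add_neg]
    rcases i with i | i
    · simpa only [hmul, Matrix.fromRows_apply_inl] using h.deriv_fst i j
    · simpa only [hmul, Matrix.fromRows_apply_inr] using h.deriv_snd i j
  intro t ht
  have := (key h).eq_of_mul hT (intervalIntegrable_hamiltonianMatrix hA) (key h')
    (by simp [h.init_fst, h.init_snd, h'.init_fst, h'.init_snd]) t ht
  exact Matrix.fromRows_inj this

/-- Along the Hamiltonian flow `⟨Z v, Y v⟩` has derivative `|Y v|² / lam + |C Z v|² ≥ 0`. -/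
theorem dotProduct_mulVec_le (hT : 0 ≤ T) (hlam : 0 < lam)
    (h : IsHamiltonianSolution T lam A C Q Z Y) (v : n → ℝ) :
    ∀ t ∈ Icc 0 T, v ⬝ᵥ Q *ᵥ v ≤ (Z t *ᵥ v) ⬝ᵥ (Y t *ᵥ v) := by
  intro t ht
  have hd := (IsPrimitiveOn.dotProduct hT (h.deriv_fst.mulVec_const hT v)
    (h.deriv_snd.mulVec_const hT v)).neg
  have := hd.apply_le_of_deriv_nonpos (fun s _ => ?_) t ht
  · rw [h.init_fst, h.init_snd, Matrix.one_mulVec] at this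
    linarith
  · rw [neg_nonpos]
    have h1 : (A s * Z s + (1 / lam) • Y s) *ᵥ v ⬝ᵥ Y s *ᵥ v +
        Z s *ᵥ v ⬝ᵥ (Cᵀ * C * Z s - (A s)ᵀ * Y s) *ᵥ v =
        (1 / lam) * (Y s *ᵥ v ⬝ᵥ Y s *ᵥ v) + (C *ᵥ Z s *ᵥ v) ⬝ᵥ (C *ᵥ Z s *ᵥ v) := by
      have e1 : Z s *ᵥ v ⬝ᵥ (A s)ᵀ *ᵥ Y s *ᵥ v = A s *ᵥ Z s *ᵥ v ⬝ᵥ Y s *ᵥ v := by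
        rw [Matrix.dotProduct_mulVec, Matrix.vecMul_transpose]
      have e2 : Z s *ᵥ v ⬝ᵥ Cᵀ *ᵥ C *ᵥ Z s *ᵥ v = C *ᵥ Z s *ᵥ v ⬝ᵥ C *ᵥ Z s *ᵥ v := by
        rw [Matrix.dotProduct_mulVec, Matrix.vecMul_transpose]
      simp only [Matrix.add_mulVec, Matrix.sub_mulVec, ← Matrix.mulVec_mulVec, add_dotProduct,
        dotProduct_sub, Matrix.smul_mulVec, smul_dotProduct, smul_eq_mul, e1, e2]
      ring
    rw [h1]
    have h2 : 0 ≤ Y s *ᵥ v ⬝ᵥ Y s *ᵥ v := Finset.sum_nonneg fun i _ => mul_self_nonneg _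
    have h3 : 0 ≤ C *ᵥ Z s *ᵥ v ⬝ᵥ C *ᵥ Z s *ᵥ v :=
      Finset.sum_nonneg fun i _ => mul_self_nonneg _
    positivity

theorem det_ne_zero (hT : 0 ≤ T) (hlam : 0 < lam) (hQ : ∀ v ≠ 0, 0 < v ⬝ᵥ Q *ᵥ v)
    (h : IsHamiltonianSolution T lam A C Q Z Y) : ∀ t ∈ Icc 0 T, (Z t).det ≠ 0 := by
  intro t ht hdet
  obtain ⟨v, hv, hZv⟩ := Matrix.exists_mulVec_eq_zero_iff.2 hdet
  have := h.dotProduct_mulVec_le hT hlam v t ht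
  rw [hZv, zero_dotProduct] at this
  exact absurd (hQ v hv) (not_lt.2 this)

theorem transpose_mul_eq (hT : 0 ≤ T) (hQ : Q.IsSymm)
    (h : IsHamiltonianSolution T lam A C Q Z Y) :
    ∀ t ∈ Icc 0 T, (Z t)ᵀ * Y t = (Y t)ᵀ * Z t := by
  have hd := (h.deriv_fst.transpose.mul hT h.deriv_snd).sub
    (h.deriv_snd.transpose.mul hT h.deriv_fst)
  intro t ht
  have := hd.eq_of_deriv_eq_zero (fun s _ => ?_) t ht
  · simp only [h.init_fst, h.init_snd, Matrix.transpose_one, hQ.eq, one_mul, mul_one,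
      sub_self] at this
    exact sub_eq_zero.1 this
  · simp only [Matrix.transpose_add, Matrix.transpose_sub, Matrix.transpose_mul,
      Matrix.transpose_smul, Matrix.transpose_transpose, Matrix.add_mul, Matrix.mul_add,
      Matrix.sub_mul, Matrix.mul_sub, Matrix.mul_assoc, Matrix.smul_mul, Matrix.mul_smul]
    abel

end IsHamiltonianSolution

/-- Existence for the Riccati equation on the whole of `[0, T]`. Besides the solution `E`, which is
symmetric and positive definite, the statement provides the fundamental matrix `Z` of the closed
loop equation `ẋ = (A + E / lam) x`. -/
theorem exists_riccati_solution (hT : 0 ≤ T) (hlam : 0 < lam)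
    (hA : ∀ i j, IntervalIntegrable (fun t => A t i j) volume 0 T)
    (hQs : Q.IsSymm) (hQ : ∀ v ≠ 0, 0 < v ⬝ᵥ Q *ᵥ v) :
    ∃ E Z : ℝ → Matrix n n ℝ,
      E 0 = Q ∧
      IsMatrixPrimitiveOn T E
        (fun t => Cᵀ * C - (A t)ᵀ * E t - E t * A t - (1 / lam) • (E t * E t)) ∧
      (∀ t ∈ Icc 0 T, (E t).IsSymm) ∧
      (∀ t ∈ Icc 0 T, ∀ v ≠ 0, 0 < v ⬝ᵥ E t *ᵥ v) ∧
      Z 0 = 1 ∧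
      IsMatrixPrimitiveOn T Z (fun t => (A t + (1 / lam) • E t) * Z t) ∧
      ∀ t ∈ Icc 0 T, (Z t).det ≠ 0 := by
  obtain ⟨Z, Y, h⟩ := exists_isHamiltonianSolution (lam := lam) (C := C) (Q := Q) hT hA
  have hdet := h.det_ne_zero hT hlam hQ
  have hZc : ContinuousOn Z (Icc 0 T) :=
    continuousOn_pi.2 fun i => continuousOn_pi.2 fun j => (h.deriv_fst i j).continuousOn
  have hYc : ContinuousOn Y (Icc 0 T) :=
    continuousOn_pi.2 fun i => continuousOn_pi.2 fun j => (h.deriv_snd i j).continuousOn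
  set E : ℝ → Matrix n n ℝ := fun t => Y t * (Z t)⁻¹ with hE
  have hEc : ContinuousOn E (Icc 0 T) := hYc.mul (Matrix.continuousOn_inv hZc hdet)
  have hZinv : ∀ t ∈ Icc 0 T, (Z t)⁻¹ * Z t = 1 := fun t ht =>
    Matrix.nonsing_inv_mul _ (isUnit_iff_ne_zero.2 (hdet t ht))
  have hZinv' : ∀ t ∈ Icc 0 T, Z t * (Z t)⁻¹ = 1 := fun t ht =>
    Matrix.mul_nonsing_inv _ (isUnit_iff_ne_zero.2 (hdet t ht))
  have hEZ : ∀ t ∈ Icc 0 T, E t * Z t = Y t := fun t ht => by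
    rw [hE]
    simp only [Matrix.mul_assoc, hZinv t ht, mul_one]
  have hEint : ∀ i j, IntervalIntegrable (fun t => E t i j) volume 0 T := fun i j => by
    refine ContinuousOn.intervalIntegrable ?_
    rw [uIcc_of_le hT]
    exact continuousOn_pi.1 (continuousOn_pi.1 hEc i) j
  -- `Z⁻¹` is identified with the solution of `Ẇ = -W (A + E / lam)`, `W(0) = 1`; this gives its
  -- derivative without differentiating an inverse.
  obtain ⟨V, hV0, hV⟩ := exists_isMatrixPrimitiveOn_mul
    (M := fun t => -(A t + (1 / lam) • E t)ᵀ) hT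
    (fun i j => ((hA j i).add ((hEint j i).const_mul (1 / lam))).neg) (1 : Matrix n n ℝ)
  have hVZ : ∀ t ∈ Icc 0 T, (V t)ᵀ * Z t = 1 := by
    intro t ht
    have := (hV.transpose.mul hT h.deriv_fst).eq_of_deriv_eq_zero (fun s hs => ?_) t ht
    · simpa [hV0, h.init_fst] using this
    · rw [← hEZ s hs]
      simp only [Matrix.transpose_mul, Matrix.transpose_neg, Matrix.transpose_transpose,
        Matrix.neg_mul, Matrix.mul_add, Matrix.add_mul, Matrix.mul_assoc,
        Matrix.smul_mul, Matrix.mul_smul]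
      abel
  have hVinv : ∀ t ∈ Icc 0 T, (V t)ᵀ = (Z t)⁻¹ := fun t ht =>
    (Matrix.inv_eq_left_inv (hVZ t ht)).symm
  have hYV : ∀ t ∈ Icc 0 T, Y t * (V t)ᵀ = E t := fun t ht => by rw [hVinv t ht]
  have hZV : ∀ t ∈ Icc 0 T, Z t * (V t)ᵀ = 1 := fun t ht => by rw [hVinv t ht, hZinv' t ht]
  refine ⟨E, Z, ?_, ?_, ?_, ?_, h.init_fst, ?_, hdet⟩
  · simp [hE, h.init_fst, h.init_snd]
  · refine (h.deriv_snd.mul hT hV.transpose).congr hYV fun t ht => ?_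
    have h1 : (Cᵀ * C * Z t - (A t)ᵀ * Y t) * (V t)ᵀ = Cᵀ * C - (A t)ᵀ * E t := by
      rw [Matrix.sub_mul, Matrix.mul_assoc, Matrix.mul_assoc (A t)ᵀ, hZV t ht, hYV t ht, mul_one]
    have h2 : Y t * (-(A t + (1 / lam) • E t)ᵀ * V t)ᵀ =
        -(E t * (A t + (1 / lam) • E t)) := by
      rw [Matrix.transpose_mul, Matrix.transpose_neg, Matrix.transpose_transpose,
        ← Matrix.mul_assoc, hYV t ht, Matrix.mul_neg]
    rw [h1, h2, Matrix.mul_add, Matrix.mul_smul]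
    abel
  · intro t ht
    have h1 := h.transpose_mul_eq hT hQs t ht
    have h2 : (E t)ᵀ = V t * ((Y t)ᵀ * Z t) * (V t)ᵀ := by
      rw [← hYV t ht, Matrix.transpose_mul, Matrix.transpose_transpose, Matrix.mul_assoc,
        Matrix.mul_assoc, hZV t ht, mul_one]
    have h3 : V t * (Z t)ᵀ = 1 := by
      simpa using congrArg Matrix.transpose (hZV t ht)
    rw [Matrix.IsSymm, h2, ← h1, Matrix.mul_assoc, Matrix.mul_assoc, hYV t ht,
      ← Matrix.mul_assoc, h3, one_mul]
  · intro t ht v hv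
    set w := (Z t)⁻¹ *ᵥ v with hw
    have hZw : Z t *ᵥ w = v := by
      rw [hw, Matrix.mulVec_mulVec, hZinv' t ht, Matrix.one_mulVec]
    have hYw : E t *ᵥ v = Y t *ᵥ w := by rw [hw, Matrix.mulVec_mulVec]
    have hw0 : w ≠ 0 := fun h0 => hv (by rw [← hZw, h0, Matrix.mulVec_zero])
    have h1 := h.dotProduct_mulVec_le hT hlam w t ht
    rw [hZw] at h1
    rw [hYw]
    exact (hQ w hw0).trans_le h1
  · refine h.deriv_fst.congr_deriv fun t ht => ?_
    rw [← hEZ t ht, Matrix.add_mul, Matrix.smul_mul]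

/-- A solution `E` of the Riccati equation yields the solution `(V, E V)` of the Hamiltonian system,
`V` being the fundamental matrix of `ẋ = (A + E / lam) x`; uniqueness follows from linear theory. -/
theorem riccati_solution_unique (hT : 0 ≤ T) (hlam : 0 < lam)
    (hA : ∀ i j, IntervalIntegrable (fun t => A t i j) volume 0 T)
    (hQ : ∀ v ≠ 0, 0 < v ⬝ᵥ Q *ᵥ v) {E E' : ℝ → Matrix n n ℝ} (h0 : E 0 = Q) (h0' : E' 0 = Q)
    (hE : IsMatrixPrimitiveOn T E
      (fun t => Cᵀ * C - (A t)ᵀ * E t - E t * A t - (1 / lam) • (E t * E t)))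
    (hE' : IsMatrixPrimitiveOn T E'
      (fun t => Cᵀ * C - (A t)ᵀ * E' t - E' t * A t - (1 / lam) • (E' t * E' t))) :
    ∀ t ∈ Icc 0 T, E t = E' t := by
  have key : ∀ {E : ℝ → Matrix n n ℝ}, E 0 = Q → IsMatrixPrimitiveOn T E
      (fun t => Cᵀ * C - (A t)ᵀ * E t - E t * A t - (1 / lam) • (E t * E t)) →
      ∃ V, IsHamiltonianSolution T lam A C Q V (fun t => E t * V t) := by
    intro E h0 hE
    obtain ⟨V, hV0, hV⟩ := exists_isMatrixPrimitiveOn_mul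
      (M := fun t => A t + (1 / lam) • E t) hT (fun i j => (hA i j).add
        (IntervalIntegrable.const_mul (ContinuousOn.intervalIntegrable (by
          rw [uIcc_of_le hT]; exact (hE i j).continuousOn)) (1 / lam))) (1 : Matrix n n ℝ)
    refine ⟨V, hV0, by simp [hV0, h0], hV.congr_deriv fun t _ => ?_,
      (hE.mul hT hV).congr_deriv fun t _ => ?_⟩
    · rw [Matrix.add_mul, Matrix.smul_mul]
    · simp only [Matrix.sub_mul, Matrix.mul_add, Matrix.add_mul, Matrix.mul_assoc,
        Matrix.smul_mul, Matrix.mul_smul]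
      abel
  obtain ⟨V, hV⟩ := key h0 hE
  obtain ⟨V', hV'⟩ := key h0' hE'
  intro t ht
  obtain ⟨h1, h2⟩ := hV.unique hT hA hV' t ht
  have hu : IsUnit (V t).det := isUnit_iff_ne_zero.2 (hV.det_ne_zero hT hlam hQ t ht)
  rw [← h1] at h2
  have h3 := congrArg (· * (V t)⁻¹) h2
  simpa [Matrix.mul_assoc, Matrix.mul_nonsing_inv _ hu] using h3

end Riccati

/-! ### Componentwise form of the Carathéodory equations -/

section Bridge

variable {d d' : ℕ} {T lam : ℝ}

@[simp]
theorem ofLp_mulV (M : Matrix (Fin d') (Fin d) ℝ) (v : Vec d) : (mulV M v).ofLp = M *ᵥ v.ofLp := rfl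

theorem Vec.inner_eq_dotProduct (v w : Vec d) : inner ℝ v w = v.ofLp ⬝ᵥ w.ofLp := by
  rw [EuclideanSpace.inner_eq_star_dotProduct, dotProduct_comm]
  simp

theorem Vec.norm_sq_eq_dotProduct (v : Vec d) : ‖v‖ ^ 2 = v.ofLp ⬝ᵥ v.ofLp := by
  rw [← real_inner_self_eq_norm_sq, Vec.inner_eq_dotProduct]

theorem Vec.intervalIntegrable_iff {a b : ℝ} {g : ℝ → Vec d} :
    IntervalIntegrable g volume a b ↔ ∀ i, IntervalIntegrable (fun s => g s i) volume a b := by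
  simp only [_root_.intervalIntegrable_iff, IntegrableOn]
  exact integrable_piLp_iff

theorem Vec.eq_add_integral_iff (hT : 0 ≤ T) {X g : ℝ → Vec d} {x₀ : Vec d} :
    (IntervalIntegrable g volume 0 T ∧ ∀ t ∈ Icc 0 T, X t = x₀ + ∫ s in (0 : ℝ)..t, g s) ↔
      X 0 = x₀ ∧ ∀ i, IsPrimitiveOn T (fun t => X t i) (fun t => g t i) := by
  have key : IntervalIntegrable g volume 0 T → ∀ t ∈ Icc 0 T, ∀ i,
      (∫ s in (0 : ℝ)..t, g s) i = ∫ s in (0 : ℝ)..t, g s i := by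
    intro hg t ht i
    rw [intervalIntegral.integral_of_le ht.1, intervalIntegral.integral_of_le ht.1,
      eval_integral_piLp]
    intro j
    exact (intervalIntegrable_iff_integrableOn_Ioc_of_le ht.1).1
      (Vec.intervalIntegrable_iff.1 (hg.mono_Icc ht) j)
  constructor
  · rintro ⟨hg, hX⟩
    have h0 : X 0 = x₀ := by simpa using hX 0 ⟨le_rfl, hT⟩
    refine ⟨h0, fun i => ⟨hT, Vec.intervalIntegrable_iff.1 hg i, fun t ht => ?_⟩⟩
    rw [← key hg t ht i, h0, hX t ht, PiLp.add_apply]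
  · rintro ⟨h0, h⟩
    have hg := Vec.intervalIntegrable_iff.2 fun i => (h i).2
    refine ⟨hg, fun t ht => ?_⟩
    ext i
    rw [PiLp.add_apply, key hg t ht i, (h i).3 t ht, h0]

theorem Vec.continuousOn_iff {X : ℝ → Vec d} {s : Set ℝ} :
    ContinuousOn X s ↔ ∀ i, ContinuousOn (fun t => X t i) s := by
  constructor
  · intro h i
    exact (PiLp.continuous_apply 2 _ i).comp_continuousOn h
  · intro h
    exact (PiLp.continuous_toLp 2 _).comp_continuousOn (continuousOn_pi.2 h)

theorem isControlledSolution_iff (hT : 0 ≤ T) {A : ℝ → Matrix (Fin d) (Fin d) ℝ} {r u X : ℝ → Vec d}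
    {x₀ : Vec d} :
    IsControlledSolution T A r x₀ u X ↔
      X 0 = x₀ ∧ IsLinearSolution T A (fun t => (r t + u t).ofLp) (fun t => (X t).ofLp) := by
  rw [IsControlledSolution, Vec.eq_add_integral_iff hT]
  have h : (∀ i, IsPrimitiveOn T (fun t => X t i)
      (fun t => (mulV (A t) (X t) + r t + u t) i)) ↔
      IsLinearSolution T A (fun t => (r t + u t).ofLp) (fun t => (X t).ofLp) :=
    forall_congr' fun i => by
      have : ∀ t, (mulV (A t) (X t) + r t + u t) i =
          (A t *ᵥ (X t).ofLp + (r t + u t).ofLp) i := fun t => by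
        simp [add_assoc]
      simp only [this]
  rw [h]
  exact ⟨fun h => h.2, fun h => ⟨Vec.continuousOn_iff.2 fun i => (h.2 i).continuousOn, h⟩⟩

theorem isAdjointSolution_iff (hT : 0 ≤ T) {A : ℝ → Matrix (Fin d) (Fin d) ℝ} {r : ℝ → Vec d}
    {C : Matrix (Fin d') (Fin d) ℝ} {ζ : ℝ → Vec d'} {E : ℝ → Matrix (Fin d) (Fin d) ℝ}
    {h : ℝ → Vec d} :
    IsAdjointSolution T A r C lam ζ E h ↔
      h 0 = 0 ∧ IsLinearSolution T (fun t => -adjointAlpha A lam E t)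
        (fun t => -(adjointBeta r C ζ E t).ofLp) (fun t => (h t).ofLp) := by
  have e := Vec.eq_add_integral_iff hT (X := h) (x₀ := 0)
    (g := fun s => -mulV (adjointAlpha A lam E s) (h s) - adjointBeta r C ζ E s)
  simp only [zero_add] at e
  rw [IsAdjointSolution, e]
  have h' : (∀ i, IsPrimitiveOn T (fun t => h t i)
      (fun t => (-mulV (adjointAlpha A lam E t) (h t) - adjointBeta r C ζ E t) i)) ↔
      IsLinearSolution T (fun t => -adjointAlpha A lam E t)
        (fun t => -(adjointBeta r C ζ E t).ofLp) (fun t => (h t).ofLp) :=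
    forall_congr' fun i => by
      have : ∀ t, (-mulV (adjointAlpha A lam E t) (h t) - adjointBeta r C ζ E t) i =
          (-adjointAlpha A lam E t *ᵥ (h t).ofLp + -(adjointBeta r C ζ E t).ofLp) i := fun t => by
        simp [sub_eq_add_neg, Matrix.neg_mulVec]
      simp only [this]
  rw [h']
  exact ⟨fun h => h.2, fun h => ⟨Vec.continuousOn_iff.2 fun i => (h.2 i).continuousOn, h⟩⟩

theorem isRiccatiSolution_iff (hT : 0 ≤ T) {A : ℝ → Matrix (Fin d) (Fin d) ℝ}
    {C : Matrix (Fin d') (Fin d) ℝ} {Q : Matrix (Fin d) (Fin d) ℝ}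
    {E : ℝ → Matrix (Fin d) (Fin d) ℝ} :
    IsRiccatiSolution T A C Q lam E ↔
      E 0 = Q ∧ IsMatrixPrimitiveOn T E (fun t => riccatiField A C lam (E t) t) := by
  constructor
  · rintro ⟨-, h⟩
    have h0 : ∀ i j, E 0 i j = Q i j := fun i j => by
      simpa using (h i j).2 0 ⟨le_rfl, hT⟩
    exact ⟨by ext i j; exact h0 i j, fun i j =>
      ⟨hT, (h i j).1, fun t ht => by rw [h0, (h i j).2 t ht]⟩⟩
  · rintro ⟨h0, h⟩
    exact ⟨continuousOn_pi.2 fun i => continuousOn_pi.2 fun j => (h i j).continuousOn,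
      fun i j => ⟨(h i j).2, fun t ht => by rw [← h0]; exact (h i j).3 t ht⟩⟩

theorem MeasureTheory.MemLp.intervalIntegrable_timeMeasure {E : Type*} [NormedAddCommGroup E]
    {f : ℝ → E} {p : ENNReal} (hT : 0 ≤ T) (hp : 1 ≤ p) (hf : MemLp f p (timeMeasure T)) :
    IntervalIntegrable f volume 0 T :=
  (intervalIntegrable_iff_integrableOn_Icc_of_le hT).2 (hf.integrable hp)

theorem ContinuousOn.memLp_timeMeasure {E : Type*} [NormedAddCommGroup E]
    [SecondCountableTopology E] [MeasurableSpace E] [BorelSpace E] {f : ℝ → E} (p : ENNReal)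
    (hf : ContinuousOn f (Icc 0 T)) : MemLp f p (timeMeasure T) := by
  obtain ⟨K, hK⟩ := isCompact_Icc.exists_bound_of_continuousOn hf
  exact MemLp.of_bound (hf.aestronglyMeasurable measurableSet_Icc) K
    ((ae_restrict_iff' measurableSet_Icc).2 (Filter.Eventually.of_forall hK))

theorem ContinuousOn.mulV {M : ℝ → Matrix (Fin d') (Fin d) ℝ} {v : ℝ → Vec d} {s : Set ℝ}
    (hM : ContinuousOn M s) (hv : ContinuousOn v s) :
    ContinuousOn (fun t => _root_.mulV (M t) (v t)) s := by
  refine Vec.continuousOn_iff.2 fun i => ?_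
  exact continuousOn_finsetSum (f := fun j t => M t i j * v t j) Finset.univ fun j _ =>
    (continuousOn_pi.1 (continuousOn_pi.1 hM i) j).mul (Vec.continuousOn_iff.1 hv j)

/-! ### The controlled trajectory -/

variable {A : ℝ → Matrix (Fin d) (Fin d) ℝ} {r : ℝ → Vec d}

theorem exists_isControlledSolution (hT : 0 ≤ T)
    (hA : ∀ i j, IntervalIntegrable (fun t => A t i j) volume 0 T)
    (hr : IntervalIntegrable r volume 0 T) (x₀ : Vec d) {u : ℝ → Vec d}
    (hu : IntervalIntegrable u volume 0 T) :
    ∃ X, IsControlledSolution T A r x₀ u X := by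
  obtain ⟨x, hx0, hx⟩ := exists_isLinearSolution (b := fun t => (r t + u t).ofLp) hT hA
    (Vec.intervalIntegrable_iff.1 (hr.add hu)) x₀.ofLp
  exact ⟨fun t => WithLp.toLp 2 (x t), (isControlledSolution_iff hT).2
    ⟨by simp [hx0], hx⟩⟩

theorem IsControlledSolution.eqOn (hT : 0 ≤ T)
    (hA : ∀ i j, IntervalIntegrable (fun t => A t i j) volume 0 T) {x₀ : Vec d}
    {u X X' : ℝ → Vec d} (h : IsControlledSolution T A r x₀ u X)
    (h' : IsControlledSolution T A r x₀ u X') : EqOn X X' (Icc 0 T) := by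
  rw [isControlledSolution_iff hT] at h h'
  intro t ht
  exact WithLp.ofLp_injective 2 (h.2.eqOn hT hA h'.2 (by simp [h.1, h'.1]) t ht)

theorem IsControlledSolution.congr_control (hT : 0 ≤ T) {x₀ : Vec d} {u u' X : ℝ → Vec d}
    (h : IsControlledSolution T A r x₀ u X) (huu : u =ᵐ[timeMeasure T] u') :
    IsControlledSolution T A r x₀ u' X := by
  have hae : ∀ᵐ s, s ∈ Icc 0 T → u s = u' s := (ae_restrict_iff' measurableSet_Icc).1 huu
  refine ⟨h.1, h.2.1.congr_ae ?_, fun t ht => ?_⟩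
  · rw [Filter.EventuallyEq, ae_restrict_iff' measurableSet_uIoc]
    filter_upwards [hae] with s hs hsT
    rw [uIoc_of_le hT] at hsT
    rw [hs ⟨hsT.1.le, hsT.2⟩]
  · rw [h.2.2 t ht]
    congr 1
    refine intervalIntegral.integral_congr_ae ?_
    filter_upwards [hae] with s hs hst
    rw [uIoc_of_le ht.1] at hst
    rw [hs ⟨hst.1.le, hst.2.trans ht.2⟩]

theorem isControlledSolution_controlledState (hT : 0 ≤ T)
    (hA : ∀ i j, IntervalIntegrable (fun t => A t i j) volume 0 T)
    (hr : IntervalIntegrable r volume 0 T) (x₀ : Vec d) (u : Control d T) :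
    IsControlledSolution T A r x₀ u (controlledState T A r x₀ u) := by
  have h := exists_isControlledSolution hT hA hr x₀
    ((Lp.memLp u).intervalIntegrable_timeMeasure hT one_le_two)
  rw [controlledState, dif_pos h]
  exact h.choose_spec

end Bridge

/-! ### Completing the square -/

section CompletingSquare

variable {d d' : ℕ} {T lam : ℝ} {A : ℝ → Matrix (Fin d) (Fin d) ℝ} {r : ℝ → Vec d}
  {C : Matrix (Fin d') (Fin d) ℝ} {Q : Matrix (Fin d) (Fin d) ℝ} {ζ : ℝ → Vec d'}
  {E : ℝ → Matrix (Fin d) (Fin d) ℝ} {h : ℝ → Vec d}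

/-- The integrand of the profiled cost, `‖ζ‖² - 2 rᵀh - ‖h‖² / lam`. -/
noncomputable def profiledIntegrand (lam : ℝ) (r : ℝ → Vec d) (ζ : ℝ → Vec d') (h : ℝ → Vec d)
    (t : ℝ) : ℝ :=
  ‖ζ t‖ ^ 2 - 2 * inner ℝ (r t) (h t) - (1 / lam) * ‖h t‖ ^ 2

/-- The feedback law `(E(t) x + h(t)) / lam`. -/
noncomputable def feedback (lam : ℝ) (E : ℝ → Matrix (Fin d) (Fin d) ℝ) (h : ℝ → Vec d) (t : ℝ)
    (x : Vec d) : Vec d :=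
  (1 / lam) • (mulV (E t) x + h t)

/-- The pointwise identity behind the verification argument: the left-hand side is the derivative
of `xᵀEx + 2hᵀx` along a trajectory `ẋ = A x + r + u`, the right-hand side is the running cost
minus the square of the deviation from the feedback law and a term independent of `x` and `u`. -/
theorem value_deriv_eq (hlam : 0 < lam) (t : ℝ) (hE : (E t).IsSymm) (x u : Vec d) :
    (A t *ᵥ x.ofLp + (r t + u).ofLp) ⬝ᵥ (E t *ᵥ x.ofLp) +
        x.ofLp ⬝ᵥ (riccatiField A C lam (E t) t *ᵥ x.ofLp +
          E t *ᵥ (A t *ᵥ x.ofLp + (r t + u).ofLp)) +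
      2 * ((-adjointAlpha A lam E t *ᵥ (h t).ofLp + -(adjointBeta r C ζ E t).ofLp) ⬝ᵥ x.ofLp +
        (h t).ofLp ⬝ᵥ (A t *ᵥ x.ofLp + (r t + u).ofLp)) =
    (‖ζ t - mulV C x‖ ^ 2 + lam * ‖u‖ ^ 2) - lam * ‖u - feedback lam E h t x‖ ^ 2
      - profiledIntegrand lam r ζ h t := by
  simp only [profiledIntegrand, feedback, Vec.norm_sq_eq_dotProduct, Vec.inner_eq_dotProduct,
    WithLp.ofLp_sub, WithLp.ofLp_add, WithLp.ofLp_smul, ofLp_mulV, adjointAlpha, adjointBeta,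
    riccatiField]
  generalize x.ofLp = x
  generalize u.ofLp = u
  generalize (h t).ofLp = h
  generalize (r t).ofLp = r
  generalize (ζ t).ofLp = ζ
  have hsymm : ∀ v w : Fin d → ℝ, v ⬝ᵥ E t *ᵥ w = E t *ᵥ v ⬝ᵥ w := fun v w => by
    rw [Matrix.dotProduct_mulVec, ← Matrix.mulVec_transpose, hE.eq]
  have htr : ∀ v w : Fin d → ℝ, v ⬝ᵥ (A t)ᵀ *ᵥ w = A t *ᵥ v ⬝ᵥ w := fun v w => by
    rw [Matrix.dotProduct_mulVec, Matrix.vecMul_transpose]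
  have htr' : ∀ v w : Fin d → ℝ, (A t)ᵀ *ᵥ v ⬝ᵥ w = A t *ᵥ w ⬝ᵥ v := fun v w => by
    rw [dotProduct_comm, htr]
  have hC : ∀ (v : Fin d → ℝ) (w : Fin d' → ℝ), v ⬝ᵥ Cᵀ *ᵥ w = C *ᵥ v ⬝ᵥ w := fun v w => by
    rw [Matrix.dotProduct_mulVec, Matrix.vecMul_transpose]
  have hC' : ∀ (v : Fin d' → ℝ) (w : Fin d → ℝ), Cᵀ *ᵥ v ⬝ᵥ w = C *ᵥ w ⬝ᵥ v := fun v w => by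
    rw [dotProduct_comm, hC]
  obtain ⟨p, hp⟩ : ∃ p, E t *ᵥ x = p := ⟨_, rfl⟩
  have hp₁ : ∀ w : Fin d → ℝ, x ⬝ᵥ E t *ᵥ w = p ⬝ᵥ w := fun w => by rw [hsymm, hp]
  have hp₂ : ∀ w : Fin d → ℝ, E t *ᵥ w ⬝ᵥ x = p ⬝ᵥ w := fun w => by rw [dotProduct_comm, hp₁]
  simp only [Matrix.sub_mulVec, Matrix.add_mulVec, Matrix.neg_mulVec, Matrix.smul_mulVec,
    ← Matrix.mulVec_mulVec, Matrix.mulVec_add, add_dotProduct, dotProduct_add, sub_dotProduct,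
    dotProduct_sub, neg_dotProduct, smul_dotProduct, dotProduct_smul, smul_eq_mul, htr, htr',
    hC, hC', hp, hp₁, hp₂]
  rw [dotProduct_comm (A t *ᵥ x) p, dotProduct_comm r p, dotProduct_comm u p,
    dotProduct_comm (A t *ᵥ x) h, dotProduct_comm (C *ᵥ x) ζ,
    dotProduct_comm r h, dotProduct_comm u h, dotProduct_comm h p]
  field_simp
  ring

theorem intervalIntegrable_profiledIntegrand (hT : 0 ≤ T) (hr : MemLp r 2 (timeMeasure T))
    (hζ : MemLp ζ 2 (timeMeasure T)) (hh : ContinuousOn h (Icc 0 T)) :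
    IntervalIntegrable (profiledIntegrand lam r ζ h) volume 0 T := by
  have hh2 : MemLp h 2 (timeMeasure T) := hh.memLp_timeMeasure 2
  have h1 : Integrable (fun t => ‖ζ t‖ ^ 2) (timeMeasure T) :=
    hζ.integrable_norm_pow (p := 2) two_ne_zero
  have h2 : Integrable (fun t => ‖h t‖ ^ 2) (timeMeasure T) :=
    hh2.integrable_norm_pow (p := 2) two_ne_zero
  have h3 : Integrable (fun t => inner ℝ (r t) (h t)) (timeMeasure T) := by
      simp only [Vec.inner_eq_dotProduct, dotProduct]
      exact integrable_finsetSum _ fun i _ => (hr.eval_piLp i).integrable_mul (hh2.eval_piLp i)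
  exact (intervalIntegrable_iff_integrableOn_Icc_of_le hT).2
    ((h1.sub (h3.const_mul 2)).sub (h2.const_mul (1 / lam)))

theorem memLp_feedback (hE : ContinuousOn E (Icc 0 T)) (hh : ContinuousOn h (Icc 0 T))
    {X : ℝ → Vec d} (hX : ContinuousOn X (Icc 0 T)) :
    MemLp (fun t => feedback lam E h t (X t)) 2 (timeMeasure T) :=
  ((hE.mulV hX).add hh).const_smul (1 / lam) |>.memLp_timeMeasure 2

/-- The cost of an arbitrary trajectory: only the terminal value of `xᵀEx + 2hᵀx` and the deviation
of the control from the feedback law depend on the trajectory. -/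
theorem cost_eq_terminal_add_deviation (hT : 0 ≤ T) (hlam : 0 < lam)
    (hr : MemLp r 2 (timeMeasure T)) (hζ : MemLp ζ 2 (timeMeasure T))
    (hE : IsRiccatiSolution T A C Q lam E) (hEs : ∀ t ∈ Icc 0 T, (E t).IsSymm)
    (hh : IsAdjointSolution T A r C lam ζ E h) {x₀ : Vec d} {u X : ℝ → Vec d}
    (hu : MemLp u 2 (timeMeasure T)) (hX : IsControlledSolution T A r x₀ u X) :
    inner ℝ x₀ (mulV Q x₀) +
        ∫ t in (0 : ℝ)..T, (‖ζ t - mulV C (X t)‖ ^ 2 + lam * ‖u t‖ ^ 2) =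
      inner ℝ (X T) (mulV (E T) (X T)) + 2 * inner ℝ (h T) (X T) +
        lam * (∫ t in (0 : ℝ)..T, ‖u t - feedback lam E h t (X t)‖ ^ 2) +
        ∫ t in (0 : ℝ)..T, profiledIntegrand lam r ζ h t := by
  obtain ⟨hX0, hXd⟩ := (isControlledSolution_iff hT).1 hX
  obtain ⟨hE0, hEd⟩ := (isRiccatiSolution_iff hT).1 hE
  obtain ⟨hh0, hhd⟩ := (isAdjointSolution_iff hT).1 hh
  have hCX : MemLp (fun t => ζ t - mulV C (X t)) 2 (timeMeasure T) :=
    hζ.sub ((continuousOn_const.mulV hX.1).memLp_timeMeasure 2)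
  have hdev : MemLp (fun t => u t - feedback lam E h t (X t)) 2 (timeMeasure T) :=
    hu.sub (memLp_feedback hE.1 hh.1 hX.1)
  have hint : ∀ {k : ℕ} {f : ℝ → Vec k}, MemLp f 2 (timeMeasure T) →
      IntervalIntegrable (fun t => ‖f t‖ ^ 2) volume 0 T := fun hf =>
    (intervalIntegrable_iff_integrableOn_Icc_of_le hT).2
      (hf.integrable_norm_pow (p := 2) two_ne_zero)
  have hI1 : IntervalIntegrable (fun t => ‖ζ t - mulV C (X t)‖ ^ 2 + lam * ‖u t‖ ^ 2) volume 0 T :=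
    (hint hCX).add ((hint hu).const_mul lam)
  have hI2 : IntervalIntegrable (fun t => lam * ‖u t - feedback lam E h t (X t)‖ ^ 2) volume 0 T :=
    (hint hdev).const_mul lam
  have hI3 := intervalIntegrable_profiledIntegrand (lam := lam) hT hr hζ hh.1
  have hV := ((IsPrimitiveOn.dotProduct hT hXd (hEd.mulVec hT hXd)).add
    ((IsPrimitiveOn.dotProduct hT hhd hXd).const_mul 2)).congr_deriv
      fun t ht => value_deriv_eq hlam t (hEs t ht) (X t) (u t)
  have hVT := hV.3 T ⟨hT, le_rfl⟩
  rw [intervalIntegral.integral_sub (hI1.sub hI2) hI3, intervalIntegral.integral_sub hI1 hI2,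
    intervalIntegral.integral_const_mul, hX0, hE0, hh0] at hVT
  simp only [Vec.inner_eq_dotProduct, ofLp_mulV]
  simp only [WithLp.ofLp_zero, zero_dotProduct, mul_zero, add_zero] at hVT
  linarith

/-- Completing the square in the terminal value. -/
theorem terminal_eq {M : Matrix (Fin d) (Fin d) ℝ} (hM : M.IsSymm) (hdet : IsUnit M.det)
    (x k : Vec d) :
    inner ℝ x (mulV M x) + 2 * inner ℝ k x =
      inner ℝ (x + mulV M⁻¹ k) (mulV M (x + mulV M⁻¹ k)) - inner ℝ k (mulV M⁻¹ k) := by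
  simp only [Vec.inner_eq_dotProduct, ofLp_mulV, WithLp.ofLp_add]
  generalize x.ofLp = x
  generalize k.ofLp = k
  have h1 : M *ᵥ M⁻¹ *ᵥ k = k := by
    rw [Matrix.mulVec_mulVec, Matrix.mul_nonsing_inv _ hdet, Matrix.one_mulVec]
  have h2 : M⁻¹ *ᵥ k ⬝ᵥ M *ᵥ x = k ⬝ᵥ x := by
    rw [Matrix.dotProduct_mulVec, ← Matrix.mulVec_transpose, hM.eq, h1]
  rw [Matrix.mulVec_add, h1]
  simp only [add_dotProduct, dotProduct_add, h2]
  rw [dotProduct_comm x k, dotProduct_comm (M⁻¹ *ᵥ k) k]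
  ring

end CompletingSquare

/-! ### The closed loop equation -/

section ClosedLoop

variable {d d' : ℕ} {T lam : ℝ} {A : ℝ → Matrix (Fin d) (Fin d) ℝ} {r : ℝ → Vec d}
  {E Z : ℝ → Matrix (Fin d) (Fin d) ℝ} {h : ℝ → Vec d}

theorem isControlledSolution_feedback_iff (hT : 0 ≤ T) {x₀ : Vec d} {X : ℝ → Vec d} :
    IsControlledSolution T A r x₀ (fun t => feedback lam E h t (X t)) X ↔
      X 0 = x₀ ∧ IsLinearSolution T (fun t => A t + (1 / lam) • E t)
        (fun t => (r t + (1 / lam) • h t).ofLp) (fun t => (X t).ofLp) := by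
  rw [isControlledSolution_iff hT, IsLinearSolution, IsLinearSolution]
  have : ∀ t, A t *ᵥ (X t).ofLp + (r t + feedback lam E h t (X t)).ofLp =
      (A t + (1 / lam) • E t) *ᵥ (X t).ofLp + (r t + (1 / lam) • h t).ofLp := fun t => by
    simp only [feedback, WithLp.ofLp_add, WithLp.ofLp_smul, ofLp_mulV, Matrix.add_mulVec,
      Matrix.smul_mulVec, smul_add]
    abel
  simp only [this]

theorem intervalIntegrable_closedLoop (hT : 0 ≤ T)
    (hA : ∀ i j, IntervalIntegrable (fun t => A t i j) volume 0 T)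
    (hE : ContinuousOn E (Icc 0 T)) (i j : Fin d) :
    IntervalIntegrable (fun t => (A t + (1 / lam) • E t) i j) volume 0 T :=
  (hA i j).add (IntervalIntegrable.const_mul (ContinuousOn.intervalIntegrable (by
    rw [uIcc_of_le hT]
    exact continuousOn_pi.1 (continuousOn_pi.1 hE i) j)) (1 / lam))

theorem intervalIntegrable_adjointAlpha (hT : 0 ≤ T)
    (hA : ∀ i j, IntervalIntegrable (fun t => A t i j) volume 0 T)
    (hE : ContinuousOn E (Icc 0 T)) (i j : Fin d) :
    IntervalIntegrable (fun t => adjointAlpha A lam E t i j) volume 0 T :=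
  intervalIntegrable_closedLoop (A := fun t => (A t)ᵀ) hT (fun i j => hA j i) hE i j

theorem intervalIntegrable_adjointBeta {C : Matrix (Fin d') (Fin d) ℝ} {ζ : ℝ → Vec d'}
    (hT : 0 ≤ T) (hr : IntervalIntegrable r volume 0 T) (hζ : IntervalIntegrable ζ volume 0 T)
    (hE : ContinuousOn E (Icc 0 T)) :
    IntervalIntegrable (adjointBeta r C ζ E) volume 0 T := by
  refine IntervalIntegrable.add (Vec.intervalIntegrable_iff.2 fun i => ?_)
    (Vec.intervalIntegrable_iff.2 fun i => ?_)
  · have : (fun s => mulV Cᵀ (ζ s) i) = ∑ j, fun s => Cᵀ i j * ζ s j := by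
      ext s
      simp [Matrix.mulVec, dotProduct]
    rw [this]
    exact IntervalIntegrable.sum _ fun j _ => (Vec.intervalIntegrable_iff.1 hζ j).const_mul _
  · have : (fun s => mulV (E s) (r s) i) = ∑ j, fun s => E s i j * r s j := by
      ext s
      simp [Matrix.mulVec, dotProduct]
    rw [this]
    refine IntervalIntegrable.sum _ fun j _ =>
      (Vec.intervalIntegrable_iff.1 hr j).continuousOn_mul ?_
    rw [uIcc_of_le hT]
    exact continuousOn_pi.1 (continuousOn_pi.1 hE i) j

/-- The closed loop equation can be solved with prescribed terminal value: a particular solution is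
corrected by `Z v`, where `Z` is the fundamental matrix. -/
theorem exists_closedLoop_of_terminal (hT : 0 ≤ T)
    (hA : ∀ i j, IntervalIntegrable (fun t => A t i j) volume 0 T)
    (hr : IntervalIntegrable r volume 0 T) (hE : ContinuousOn E (Icc 0 T))
    (hh : ContinuousOn h (Icc 0 T))
    (hZ : IsMatrixPrimitiveOn T Z (fun t => (A t + (1 / lam) • E t) * Z t))
    (hdet : (Z T).det ≠ 0) (y : Vec d) :
    ∃ X : ℝ → Vec d, X T = y ∧
      IsControlledSolution T A r (X 0) (fun t => feedback lam E h t (X t)) X := by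
  have hh' : IntervalIntegrable h volume 0 T :=
    ContinuousOn.intervalIntegrable (by rwa [uIcc_of_le hT])
  obtain ⟨x, -, hx⟩ := exists_isLinearSolution (b := fun t => (r t + (1 / lam) • h t).ofLp) hT
    (intervalIntegrable_closedLoop (lam := lam) hT hA hE)
    (Vec.intervalIntegrable_iff.1 (hr.add (hh'.smul (1 / lam)))) 0
  set v := (Z T)⁻¹ *ᵥ (y.ofLp - x T) with hv
  have hZv : IsLinearSolution T (fun t => A t + (1 / lam) • E t) 0 (fun t => Z t *ᵥ v) := fun i =>
    (hZ.mulVec_const hT v i).congr_deriv fun t _ => by simp [Matrix.mulVec_mulVec]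
  have hsum := hx.add hZv
  rw [add_zero] at hsum
  refine ⟨fun t => WithLp.toLp 2 (x t + Z t *ᵥ v), ?_,
    (isControlledSolution_feedback_iff hT).2 ⟨rfl, hsum⟩⟩
  have : Z T *ᵥ v = y.ofLp - x T := by
    rw [hv, Matrix.mulVec_mulVec, Matrix.mul_nonsing_inv _ (isUnit_iff_ne_zero.2 hdet),
      Matrix.one_mulVec]
  simp [this]

theorem closedLoop_eqOn_of_terminal_eq (hT : 0 ≤ T)
    (hA : ∀ i j, IntervalIntegrable (fun t => A t i j) volume 0 T)
    (hE : ContinuousOn E (Icc 0 T)) (hZ0 : Z 0 = 1)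
    (hZ : IsMatrixPrimitiveOn T Z (fun t => (A t + (1 / lam) • E t) * Z t))
    (hdet : (Z T).det ≠ 0) {X X' : ℝ → Vec d} {x₀ x₀' : Vec d}
    (hX : IsControlledSolution T A r x₀ (fun t => feedback lam E h t (X t)) X)
    (hX' : IsControlledSolution T A r x₀' (fun t => feedback lam E h t (X' t)) X')
    (hXT : X T = X' T) : EqOn X X' (Icc 0 T) := by
  have hM := intervalIntegrable_closedLoop (lam := lam) hT hA hE
  have hd := ((isControlledSolution_feedback_iff hT).1 hX).2.sub
    ((isControlledSolution_feedback_iff hT).1 hX').2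
  rw [sub_self] at hd
  set w := (X 0).ofLp - (X' 0).ofLp with hw
  have hZw : IsLinearSolution T (fun t => A t + (1 / lam) • E t) 0 (fun t => Z t *ᵥ w) := fun i =>
    (hZ.mulVec_const hT w i).congr_deriv fun t _ => by simp [Matrix.mulVec_mulVec]
  have heq := hd.eqOn hT hM hZw (by simp [hZ0, hw])
  have hw0 : w = 0 := by
    have h1 := heq T ⟨hT, le_rfl⟩
    simp only [Pi.sub_apply, hXT, sub_self] at h1
    exact Matrix.eq_zero_of_mulVec_eq_zero hdet h1.symm
  intro t ht
  have h1 := heq t ht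
  simp only [Pi.sub_apply, hw0, Matrix.mulVec_zero] at h1
  exact WithLp.ofLp_injective 2 (sub_eq_zero.1 h1)

end ClosedLoop

/-! ### Optimal pair and profiled cost -/

theorem mainTheorem3 {d d' p : ℕ} (T : ℝ) (hT : 0 < T)
    (Θ : Set (Vec p))
    (A : Vec p → ℝ → Matrix (Fin d) (Fin d) ℝ) (r : Vec p → ℝ → Vec d)
    (hA : ∀ θ ∈ Θ, ∀ i j : Fin d, MemLp (fun t => A θ t i j) 2 (timeMeasure T))
    (hr : ∀ θ ∈ Θ, MemLp (r θ) 2 (timeMeasure T))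
    (C : Matrix (Fin d') (Fin d) ℝ)
    (ζ : ℝ → Vec d') (hζ : MemLp ζ ⊤ (timeMeasure T))
    (θ : Vec p) (hθ : θ ∈ Θ) (lam : ℝ) (hlam : 0 < lam)
    (Q : Matrix (Fin d) (Fin d) ℝ) (hQ : Q.PosDef) :
    -- the controlled equation has exactly one solution on `[0, T]`
    (∀ (x₀ : Vec d) (u : Control d T),
      ∃ X : ℝ → Vec d, IsControlledSolution T (A θ) (r θ) x₀ u X ∧
        ∀ X' : ℝ → Vec d, IsControlledSolution T (A θ) (r θ) x₀ u X' → EqOn X' X (Icc 0 T)) ∧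
    -- the optimal pair exists and is unique
    ∃ (xhat : Vec d) (ubar : Control d T),
      IsOptimalPair T (A θ) (r θ) C Q lam ζ xhat ubar ∧
      (∀ (x₀ : Vec d) (u : Control d T),
        IsOptimalPair T (A θ) (r θ) C Q lam ζ x₀ u → x₀ = xhat ∧ u = ubar) ∧
      -- the initial value problem for `(E, h)` has exactly one solution on `[0, T]`
      ∃ (E : ℝ → Matrix (Fin d) (Fin d) ℝ) (h : ℝ → Vec d),
        IsRiccatiSolution T (A θ) C Q lam E ∧
        IsAdjointSolution T (A θ) (r θ) C lam ζ E h ∧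
        (∀ (E' : ℝ → Matrix (Fin d) (Fin d) ℝ) (h' : ℝ → Vec d),
          IsRiccatiSolution T (A θ) C Q lam E' →
          IsAdjointSolution T (A θ) (r θ) C lam ζ E' h' →
            EqOn E' E (Icc 0 T) ∧ EqOn h' h (Icc 0 T)) ∧
        -- feedback form of the optimal control
        (∀ᵐ t ∂(timeMeasure T),
          ubar t = (1 / lam) •
            (mulV (E t) (controlledState T (A θ) (r θ) xhat ubar t) + h t)) ∧
        (∀ t ∈ Icc (0 : ℝ) T, (E t).IsSymm) ∧
        IsUnit (E T).det ∧
        -- closed form of the profiled cost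
        profiledCost T (A θ) (r θ) C Q lam ζ =
          (∫ t in (0 : ℝ)..T,
            (‖ζ t‖ ^ 2 - 2 * inner ℝ (r θ t) (h t) - (1 / lam) * ‖h t‖ ^ 2))
          - inner ℝ (h T) (mulV (E T)⁻¹ (h T)) ∧
        -- final state
        controlledState T (A θ) (r θ) xhat ubar T = -mulV (E T)⁻¹ (h T) := by
  replace hA : ∀ i j, IntervalIntegrable (fun t => A θ t i j) volume 0 T := fun i j =>
    (hA θ hθ i j).intervalIntegrable_timeMeasure hT.le one_le_two
  replace hr := hr θ hθ
  have hr1 := hr.intervalIntegrable_timeMeasure hT.le one_le_two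
  have hζ2 : MemLp ζ 2 (timeMeasure T) := hζ.mono_exponent le_top
  generalize A θ = A at *
  generalize r θ = r at *
  have hQs : Q.IsSymm := by
    have := hQ.isHermitian
    rwa [Matrix.IsHermitian, Matrix.conjTranspose_eq_transpose_of_trivial] at this
  have hQpos : ∀ v ≠ 0, 0 < v ⬝ᵥ Q *ᵥ v := fun v hv => by
    simpa using hQ.dotProduct_mulVec_pos hv
  have hTT : T ∈ Icc 0 T := ⟨hT.le, le_rfl⟩
  have hstate := isControlledSolution_controlledState hT.le hA hr1
  obtain ⟨E, Z, hE0, hEd, hEs, hEpos, hZ0, hZ, hZdet⟩ :=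
    exists_riccati_solution (C := C) hT.le hlam hA hQs hQpos
  have hE : IsRiccatiSolution T A C Q lam E := (isRiccatiSolution_iff hT.le).2 ⟨hE0, hEd⟩
  have hα := intervalIntegrable_adjointAlpha (lam := lam) hT.le hA hE.1
  have hβ := intervalIntegrable_adjointBeta (C := C) hT.le hr1
    (hζ2.intervalIntegrable_timeMeasure hT.le one_le_two) hE.1
  obtain ⟨k, hk0, hk⟩ := exists_isLinearSolution hT.le (fun i j => (hα i j).neg)
    (fun i => (Vec.intervalIntegrable_iff.1 hβ i).neg) 0
  obtain ⟨h, rfl⟩ : ∃ h : ℝ → Vec d, k = fun t => (h t).ofLp := ⟨fun t => WithLp.toLp 2 (k t), rfl⟩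
  have hh : IsAdjointSolution T A r C lam ζ E h :=
    (isAdjointSolution_iff hT.le).2 ⟨WithLp.ofLp_injective 2 hk0, hk⟩
  have hETdet : IsUnit (E T).det := by
    refine isUnit_iff_ne_zero.2 fun h0 => ?_
    obtain ⟨v, hv, hEv⟩ := Matrix.exists_mulVec_eq_zero_iff.2 h0
    simpa [hEv] using hEpos T hTT v hv
  have hETpos : ∀ v : Vec d, 0 ≤ inner ℝ v (mulV (E T) v) ∧
      (inner ℝ v (mulV (E T) v) = 0 → v = 0) := fun v => by
    rw [Vec.inner_eq_dotProduct, ofLp_mulV]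
    rcases eq_or_ne v 0 with rfl | hv
    · simp
    · have h1 := hEpos T hTT v.ofLp (fun h0 => hv (WithLp.ofLp_injective 2 h0))
      exact ⟨h1.le, fun h0 => absurd h0 h1.ne'⟩
  -- `S` is the minimal cost; it is attained exactly by feedback trajectories that end at
  -- `-E(T)⁻¹ h(T)`.
  set S := (∫ t in (0 : ℝ)..T, profiledIntegrand lam r ζ h t)
    - inner ℝ (h T) (mulV (E T)⁻¹ (h T)) with hS
  have hdev : ∀ (x₀ : Vec d) (u : Control d T), MemLp
      (fun t => u t - feedback lam E h t (controlledState T A r x₀ u t)) 2 (timeMeasure T) :=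
    fun x₀ u => (Lp.memLp u).sub (memLp_feedback hE.1 hh.1 (hstate x₀ u).1)
  have hcost : ∀ (x₀ : Vec d) (u : Control d T), kalmanCost T A r C Q lam ζ x₀ u =
      inner ℝ (controlledState T A r x₀ u T + mulV (E T)⁻¹ (h T))
        (mulV (E T) (controlledState T A r x₀ u T + mulV (E T)⁻¹ (h T))) +
      lam * (∫ t in (0 : ℝ)..T,
        ‖u t - feedback lam E h t (controlledState T A r x₀ u t)‖ ^ 2) + S := by
    intro x₀ u
    rw [kalmanCost, cost_eq_terminal_add_deviation hT.le hlam hr hζ2 hE hEs hh (Lp.memLp u)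
      (hstate x₀ u), terminal_eq (hEs T hTT) hETdet, hS]
    ring
  have hint0 : ∀ (x₀ : Vec d) (u : Control d T), 0 ≤ ∫ t in (0 : ℝ)..T,
      ‖u t - feedback lam E h t (controlledState T A r x₀ u t)‖ ^ 2 := fun x₀ u =>
    intervalIntegral.integral_nonneg hT.le fun t _ => sq_nonneg _
  have hge : ∀ (x₀ : Vec d) (u : Control d T), S ≤ kalmanCost T A r C Q lam ζ x₀ u := by
    intro x₀ u
    rw [hcost]
    have h1 := (hETpos (controlledState T A r x₀ u T + mulV (E T)⁻¹ (h T))).1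
    have h2 := mul_nonneg hlam.le (hint0 x₀ u)
    linarith
  obtain ⟨Xhat, hXT, hXhat⟩ := exists_closedLoop_of_terminal hT.le hA hr1 hE.1 hh.1 hZ
    (hZdet T hTT) (-mulV (E T)⁻¹ (h T))
  have hfb := memLp_feedback (lam := lam) hE.1 hh.1 hXhat.1
  -- `feedback` is evaluated along `Xhat`; `Xhat` is then identified with the trajectory of `ubar`.
  set ubar : Control d T := hfb.toLp _ with hubar
  have hubar_ae : ubar =ᵐ[timeMeasure T] fun t => feedback lam E h t (Xhat t) := hfb.coeFn_toLp
  have hXeq : EqOn (controlledState T A r (Xhat 0) ubar) Xhat (Icc 0 T) :=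
    (hstate (Xhat 0) ubar).eqOn hT.le hA (hXhat.congr_control hT.le hubar_ae.symm)
  have hfinal : controlledState T A r (Xhat 0) ubar T = -mulV (E T)⁻¹ (h T) := by
    rw [hXeq hTT, hXT]
  have hfeed : ∀ᵐ t ∂(timeMeasure T),
      ubar t = feedback lam E h t (controlledState T A r (Xhat 0) ubar t) := by
    filter_upwards [hubar_ae, ae_restrict_mem measurableSet_Icc] with t ht htT
    rw [ht, hXeq htT]
  have hmin : kalmanCost T A r C Q lam ζ (Xhat 0) ubar = S := by
    have h1 : ∫ t in (0 : ℝ)..T,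
        ‖ubar t - feedback lam E h t (controlledState T A r (Xhat 0) ubar t)‖ ^ 2 = 0 := by
      rw [intervalIntegral.integral_of_le hT.le, ← integral_Icc_eq_integral_Ioc]
      refine integral_eq_zero_of_ae ?_
      filter_upwards [hfeed] with t ht
      rw [← ht]
      simp
    rw [hcost, h1, hfinal]
    simp
  refine ⟨fun x₀ u => ⟨_, hstate x₀ u, fun X' hX' => hX'.eqOn hT.le hA (hstate x₀ u)⟩,
    Xhat 0, ubar, fun y₀ v => hmin.trans_le (hge y₀ v), fun x₀ u hopt => ?_,
    E, h, hE, hh, fun E' h' hE' hh' => ?_, hfeed, hEs, hETdet, ?_, hfinal⟩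
  · -- An optimal pair makes both nonnegative terms of `hcost` vanish, so that its trajectory
    -- solves the closed loop equation with the same terminal value as `Xhat`.
    have hle : kalmanCost T A r C Q lam ζ x₀ u ≤ S := (hopt (Xhat 0) ubar).trans_eq hmin
    rw [hcost] at hle
    set X := controlledState T A r x₀ u with hX
    have h1 := hETpos (X T + mulV (E T)⁻¹ (h T))
    have h2 := mul_nonneg hlam.le (hint0 x₀ u)
    have hXTeq : X T = Xhat T := by
      rw [hXT]
      exact eq_neg_of_add_eq_zero_left (h1.2 (le_antisymm (by linarith [h1.1]) h1.1))
    have hI0 : ∫ t in (0 : ℝ)..T, ‖u t - feedback lam E h t (X t)‖ ^ 2 = 0 := by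
      refine le_antisymm ?_ (hint0 x₀ u)
      exact nonpos_of_mul_nonpos_right (by linarith [h1.1]) hlam
    have hu_ae : u =ᵐ[timeMeasure T] fun t => feedback lam E h t (X t) := by
      rw [intervalIntegral.integral_of_le hT.le, ← integral_Icc_eq_integral_Ioc,
        integral_eq_zero_iff_of_nonneg (fun t => sq_nonneg _)
          ((hdev x₀ u).integrable_norm_pow (p := 2) two_ne_zero)] at hI0
      filter_upwards [hI0] with t ht
      exact sub_eq_zero.1 (norm_eq_zero.1 (pow_eq_zero_iff two_ne_zero |>.1 ht))
    have hXX : EqOn X Xhat (Icc 0 T) := closedLoop_eqOn_of_terminal_eq hT.le hA hE.1 hZ0 hZ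
      (hZdet T hTT) ((hstate x₀ u).congr_control hT.le hu_ae) hXhat hXTeq
    refine ⟨?_, ?_⟩
    · rw [← hXX ⟨le_rfl, hT.le⟩]
      exact ((isControlledSolution_iff hT.le).1 (hstate x₀ u)).1.symm
    · refine Lp.ext ?_
      filter_upwards [hu_ae, hubar_ae, ae_restrict_mem measurableSet_Icc] with t h3 h4 h5
      rw [h3, h4, hXX h5]
  · obtain ⟨hE0', hEd'⟩ := (isRiccatiSolution_iff hT.le).1 hE'
    have hEE : EqOn E' E (Icc 0 T) :=
      riccati_solution_unique hT.le hlam hA hQpos hE0' hE0 hEd' hEd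
    refine ⟨hEE, fun t ht => WithLp.ofLp_injective 2 ?_⟩
    obtain ⟨hh0', hhd'⟩ := (isAdjointSolution_iff hT.le).1 hh'
    have hhd : IsLinearSolution T (fun t => -adjointAlpha A lam E t)
        (fun t => -(adjointBeta r C ζ E t).ofLp) (fun t => (h' t).ofLp) := fun i =>
      (hhd' i).congr_deriv fun s hs => by
        simp only [adjointAlpha, adjointBeta, hEE hs]
    exact hhd.eqOn hT.le (fun i j => (hα i j).neg) hk (by rw [hh0']; exact hk0.symm) t ht
  · refine le_antisymm ?_ ?_
    · have hbdd : ∀ x₀, BddBelow (range fun u : Control d T =>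
          kalmanCost T A r C Q lam ζ x₀ u) := fun x₀ =>
        ⟨S, by rintro _ ⟨u, rfl⟩; exact hge x₀ u⟩
      refine (ciInf_le ⟨S, ?_⟩ (Xhat 0)).trans ((ciInf_le (hbdd _) ubar).trans hmin.le)
      rintro _ ⟨x₀, rfl⟩
      exact le_ciInf (hge x₀)
    · exact le_ciInf fun x₀ => le_ciInf (hge x₀)
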